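/- Let $n\ge 2$, $p\ge 2$, $g\in L^2(\mathbb R^n)$. Let $\sigma,\beta:\mathbb R^n\to\mathbb R$ and $f:\mathbb R\to\mathbb R$ satisfy - $\sigma\in L^1_{loc}(\mathbb R^n)$, $\sigma\ge 0$, $\sigma^{-\frac{2n}{n(p-2)+2p}}\in L^1_{loc}(\mathbb R^n)$ (the negative power being $+\infty$ where $\sigma=0$); - $\beta\in L^\infty(\mathbb R^n)$, $\beta\ge 0$, and for some $r_0,\beta_0>0$, $\beta(x)\ge\beta_0$ for a.e. $x$ with $|x|\ge r_0$; - $f\in C^1(\mathbb R)$, $f(s)s\ge 0$ and $f'(s)>-c$ for all $s\in\mathbb R$, where $c>0$. Let $W$ be the closure of $C_0^\infty(\mathbb R^n)$ in the norm $\|u\|_W=\big(\int\sigma|\nabla u|^p\,dx\big)^{1/p}+\big(\int\beta|u|^2\,dx\big)^{1/2}$; under the above conditions $W\subset L^2(\mathbb R^n)$. For $w,z\in W$ let $\langle Aw,z\rangle=\int\sigma|\nabla w|^{p-2}\nabla w\cdot\nabla z\,dx+\int\beta wz\,dx$. For $T\ge 0$ and $u_0\in L^2(\mathbb R^n)$,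 a weak solution on $[0,T]$ of $$u_t-\operatorname{div}\big(\sigma(x)|\nabla u|^{p-2}\nabla u\big)+\beta(x)u+f(u)=g(x),\qquad u(0)=u_0,$$ is a function $u\in C([0,T];L^2(\mathbb R^n))\cap L^p(0,T;W)\cap W^{1,2}_{loc}(0,T;L^2(\mathbb R^n))$ with $u(0)=u_0$ and $\int_0^T\!\int_{\mathbb R^n}f(u)u\,dx\,dt<\infty$, such that for every $v\in W\cap L^\infty(\mathbb R^n)$, $$\int u_t v\,dx+\langle Au,v\rangle+\int f(u)v\,dx=\int gv\,dx\qquad\text{for a.e. }t\in(0,T).$$ **Theorem.** Let $T\ge0$ and let $u,v$ be weak solutions on $[0,T]$ with initial data $u_0,v_0\in L^2(\mathbb R^n)$, respectively. Then $$\|u(t)-v(t)\|_{L^2(\mathbb R^n)}\le e^{ct}\,\|u_0-v_0\|_{L^2(\mathbb R^n)}\qquad\text{for all }t\in[0,T];$$ in particular this holds at $t=T$, so that if $u,v$ are weak solutions on $[0,T]$ for every $T$, the estimate holds for all $t\ge0$. Consequently, if $u_0=v_0$ then $u(t)=v(t)$ for all $t\in[0,T]$. -/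

import Mathlib

open MeasureTheory Set Filter Topology
open scoped ContDiff ENNReal

namespace WeightedPLaplace

/-- `ℝⁿ` with the Euclidean norm. -/
abbrev Space (n : ℕ) : Type := EuclideanSpace ℝ (Fin n)

/-- `L²(ℝⁿ)`, with Lebesgue measure. -/
abbrev L2 (n : ℕ) : Type := Lp ℝ 2 (volume : Measure (Space n))

instance factOneLe (p : ℝ) [h : Fact (2 ≤ p)] : Fact (1 ≤ ENNReal.ofReal p) :=
  ⟨by
    have h2 : (2 : ℝ) ≤ p := h.out
    rw [← ENNReal.ofReal_one]
    exact ENNReal.ofReal_le_ofReal (by linarith)⟩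

/-! ### Assumptions on the coefficients -/

/-- `σ ∈ L¹_loc(ℝⁿ)`, `σ ≥ 0` and `σ ^ (-2n / (n (p - 2) + 2p)) ∈ L¹_loc(ℝⁿ)`.
The negative power is taken in `[0, ∞]`, so it is `∞` where `σ = 0`. -/
structure DiffusionCondition (n : ℕ) (p : ℝ) (σ : Space n → ℝ) : Prop where
  locallyIntegrable : LocallyIntegrable σ volume
  nonneg : ∀ᵐ x, 0 ≤ σ x
  locallyIntegrable_negPow : ∀ K : Set (Space n), IsCompact K →
    ∫⁻ x in K, ENNReal.ofReal (σ x) ^ (-(2 * (n : ℝ) / ((n : ℝ) * (p - 2) + 2 * p))) < ⊤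

/-- `β ∈ L^∞(ℝⁿ)`, `β ≥ 0`, and `β ≥ β₀ > 0` a.e. outside some ball. -/
structure DampingCondition (n : ℕ) (β : Space n → ℝ) : Prop where
  essBounded : MemLp β ⊤ volume
  nonneg : ∀ᵐ x, 0 ≤ β x
  positive_far : ∃ r₀ : ℝ, 0 < r₀ ∧ ∃ β₀ : ℝ, 0 < β₀ ∧ ∀ᵐ x, r₀ ≤ ‖x‖ → β₀ ≤ β x

/-- `f ∈ C¹(ℝ)`, `f(s) s ≥ 0` for all `s`, `f' > -c`, `c > 0`. -/
structure SourceCondition (f : ℝ → ℝ) (c : ℝ) : Prop where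
  contDiff : ContDiff ℝ 1 f
  sign : ∀ s : ℝ, 0 ≤ f s * s
  c_pos : 0 < c
  deriv_gt : ∀ s : ℝ, -c < deriv f s

/-! ### The space `W` -/

/-- The measure `ρ(x) dx`. -/
noncomputable def weighted {n : ℕ} (ρ : Space n → ℝ) : Measure (Space n) :=
  volume.withDensity fun x => ENNReal.ofReal (ρ x)

/-- `φ ∈ C₀^∞(ℝⁿ)`. -/
def IsTest {n : ℕ} (φ : Space n → ℝ) : Prop :=
  ContDiff ℝ ∞ φ ∧ HasCompactSupport φ

/-- `L^p_σ(ℝⁿ; ℝⁿ) × L²_β(ℝⁿ)` with the norm `‖(G, u)‖ = ‖G‖_{L^p_σ} + ‖u‖_{L²_β}`. -/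
abbrev Ambient (n : ℕ) (p : ℝ) (σ β : Space n → ℝ) : Type :=
  WithLp 1 (Lp (Space n) (ENNReal.ofReal p) (weighted σ) × Lp ℝ 2 (weighted β))

/-- The copy of `C₀^∞(ℝⁿ)` given by the pairs `(∇φ, φ)`; on it the norm of `Ambient` is
`‖φ‖_W = ‖∇φ‖_{L^p_σ} + ‖φ‖_{L²_β}`. -/
noncomputable def testSubmodule (n : ℕ) (p : ℝ) [Fact (2 ≤ p)] (σ β : Space n → ℝ) :
    Submodule ℝ (Ambient n p σ β) where
  carrier := {w | ∃ φ : Space n → ℝ, IsTest φ ∧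
    w.fst =ᵐ[weighted σ] gradient φ ∧ w.snd =ᵐ[weighted β] φ}
  zero_mem' := by
    refine ⟨fun _ => 0, ⟨contDiff_const, HasCompactSupport.zero⟩, ?_, ?_⟩
    · filter_upwards [Lp.coeFn_zero (Space n) (ENNReal.ofReal p) (weighted σ)] with x hx
      simpa [gradient] using hx
    · exact Lp.coeFn_zero ℝ 2 (weighted β)
  add_mem' := by
    rintro a b ⟨φ, hφ, ha1, ha2⟩ ⟨ψ, hψ, hb1, hb2⟩
    refine ⟨φ + ψ, ⟨hφ.1.add hψ.1, hφ.2.add hψ.2⟩, ?_, ?_⟩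
    · filter_upwards [Lp.coeFn_add a.fst b.fst, ha1, hb1] with x hx h1 h2
      have e1 : DifferentiableAt ℝ φ x := (hφ.1.differentiable (by simp)).differentiableAt
      have e2 : DifferentiableAt ℝ ψ x := (hψ.1.differentiable (by simp)).differentiableAt
      rw [WithLp.add_fst, hx, Pi.add_apply, h1, h2]
      simp [gradient, fderiv_add e1 e2]
    · filter_upwards [Lp.coeFn_add a.snd b.snd, ha2, hb2] with x hx h1 h2
      rw [WithLp.add_snd, hx, Pi.add_apply, h1, h2, Pi.add_apply]
  smul_mem' := by
    rintro r a ⟨φ, hφ, ha1, ha2⟩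
    refine ⟨r • φ, ⟨contDiff_const.smul hφ.1, hφ.2.smul_left (f := fun _ => r)⟩, ?_, ?_⟩
    · filter_upwards [Lp.coeFn_smul r a.fst, ha1] with x hx h1
      have e1 : DifferentiableAt ℝ φ x := (hφ.1.differentiable (by simp)).differentiableAt
      rw [WithLp.smul_fst, hx, Pi.smul_apply, h1]
      simp [gradient, fderiv_const_smul e1 r]
    · filter_upwards [Lp.coeFn_smul r a.snd, ha2] with x hx h1
      rw [WithLp.smul_snd, hx, Pi.smul_apply, h1, Pi.smul_apply]

/-- The Banach space `W`: the closure of `C₀^∞(ℝⁿ)` in the norm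
`‖u‖_W = ‖∇u‖_{L^p_σ} + ‖u‖_{L²_β}`. For `w : W`, the gradient is `w.1.fst`. -/
noncomputable def W (n : ℕ) (p : ℝ) [Fact (2 ≤ p)] (σ β : Space n → ℝ) :
    Submodule ℝ (Ambient n p σ β) :=
  (testSubmodule n p σ β).topologicalClosure

/-- The gradient in `L^p_σ(ℝⁿ; ℝⁿ)` of an element of `W`. -/
noncomputable def W.grad {n : ℕ} {p : ℝ} [Fact (2 ≤ p)] {σ β : Space n → ℝ}
    (w : W n p σ β) : Lp (Space n) (ENNReal.ofReal p) (weighted σ) :=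
  w.1.fst

/-- The inclusion `W ⊂ L²(ℝⁿ)`: `u` is the function of class `L²(ℝⁿ)` given by `w ∈ W`, that is,
some `φ_m ∈ C₀^∞(ℝⁿ)` converge to `w` in `W` and to `u` in `L²(ℝⁿ)`. (Since `β` may vanish
on a bounded set, the component of `w` in `L²_β` does not display the values of `u` there.) -/
def W.Represents {n : ℕ} {p : ℝ} [Fact (2 ≤ p)] {σ β : Space n → ℝ}
    (w : W n p σ β) (u : L2 n) : Prop :=
  ∃ φ : ℕ → Space n → ℝ, (∀ m, IsTest (φ m)) ∧
    Tendsto (fun m => eLpNorm (fun x => gradient (φ m) x - w.1.fst x)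
        (ENNReal.ofReal p) (weighted σ)
      + eLpNorm (fun x => φ m x - w.1.snd x) 2 (weighted β)) atTop (𝓝 0) ∧
    Tendsto (fun m => eLpNorm (fun x => φ m x - u x) 2 volume) atTop (𝓝 0)

/-! ### Weak solutions -/

/-- `u' ∈ L²_loc(0, T; X)` is the weak derivative of `u : (0, T) → X`. -/
structure IsWeakTimeDeriv {X : Type*} [NormedAddCommGroup X] [NormedSpace ℝ X]
    (T : ℝ) (u u' : ℝ → X) : Prop where
  memLp_loc : ∀ a b : ℝ, 0 < a → b < T → MemLp u' 2 (volume.restrict (Ioo a b))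
  integral_eq : ∀ η : ℝ → ℝ, ContDiff ℝ ∞ η → HasCompactSupport η → tsupport η ⊆ Ioo 0 T →
    ∫ t in Ioo 0 T, deriv η t • u t = -∫ t in Ioo 0 T, η t • u' t

/-- The operator `A w = -div(σ |∇w|^{p-2} ∇w) + β w` from `W` to its dual:
`⟨A w, z⟩ = ∫ σ |∇w|^{p-2} ∇w · ∇z dx + ∫ β w z dx`. -/
noncomputable def pairA {n : ℕ} {p : ℝ} [Fact (2 ≤ p)] {σ β : Space n → ℝ}
    (w z : W n p σ β) : ℝ :=
  (∫ x, σ x * (‖W.grad w x‖ ^ (p - 2) * inner ℝ (W.grad w x) (W.grad z x)))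
    + ∫ x, β x * (w.1.snd x * z.1.snd x)

/-- `u : [0, T] → L²(ℝⁿ)` is a weak solution on `[0, T]` of
`u_t - div(σ |∇u|^{p-2} ∇u) + β u + f(u) = g`, `u(0) = u₀`. -/
def IsWeakSolution {n : ℕ} (p : ℝ) [Fact (2 ≤ p)] (σ β : Space n → ℝ) (f : ℝ → ℝ) (g : L2 n)
    (T : ℝ) (u₀ : L2 n) (u : ℝ → L2 n) : Prop :=
  -- the regularity `u ∈ C([0, T]; L²(ℝⁿ))` and the initial condition
  ContinuousOn u (Icc 0 T) ∧ u 0 = u₀ ∧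
  -- the integral of `f(u) u` over `(0, T) × ℝⁿ` is finite
  (∫⁻ t in Ioo 0 T, ∫⁻ x, ENNReal.ofReal (f (u t x) * u t x)) < ⊤ ∧
  -- `u ∈ L^p(0, T; W)`, seen through `U : (0, T) → W`
  ∃ U : ℝ → W n p σ β,
    MemLp U (ENNReal.ofReal p) (volume.restrict (Ioo 0 T)) ∧
    (∀ᵐ t ∂(volume.restrict (Ioo 0 T)), W.Represents (U t) (u t)) ∧
    -- `u ∈ W^{1,2}_loc(0, T; L²(ℝⁿ))`
    ∃ u' : ℝ → L2 n, IsWeakTimeDeriv T u u' ∧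
      -- the equation tested with every element of `W ∩ L^∞(ℝⁿ)`, a.e. on `(0, T)`
      ∀ (z : W n p σ β) (v : L2 n), W.Represents z v → MemLp v ⊤ volume →
        ∀ᵐ t ∂(volume.restrict (Ioo 0 T)),
          (∫ x, u' t x * v x) + pairA (U t) z + (∫ x, f (u t x) * v x) = ∫ x, g x * v x

end WeightedPLaplace

/-! Formally, subtract the two equations and test with `w = u - v`. The operator `A` is monotone and
`f' > -c`, so `(1/2) d/dt ‖w‖² ≤ c ‖w‖²`, and Grönwall's inequality concludes. Three points make
this rigorous.

The difference `w` need not be bounded, so it is replaced by `h_m(w)`, where `h_m` is smooth,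
bounded, with `0 ≤ h_m' ≤ 1` and `h_m(s) → s`. The chain rule in `W` (`W.Represents.exists_comp`)
makes `h_m(w)` admissible with gradient `h_m'(w) ∇w`. The diffusion, damping and source terms then
have one-sided bounds uniform in `m`, so only the time derivative term is passed to the limit
(`inner_sub_le_of_testedEquation`).

The test function `h_m(w(t))` depends on `t`, while the exceptional null set of times in the
equation depends on the test function. Separability of `W × L²` gives a single null set for all
bounded test functions (`ae_forall_testedEquation`). Passing from a countable dense set to its
closure requires a uniform bound `K`, because `f(u)` is only a sum of an `L²` and an `L¹` function.

The time derivative is only locally `L²` in `(0, T)`. It is shown to be the derivative in the sense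
of the fundamental theorem of calculus on compact subintervals (`IsWeakTimeDeriv.sub_eq_integral`),
which yields the energy inequality there; continuity in `L²` carries the estimate to both endpoints.
-/

namespace WeightedPLaplace

/-! ### Weak time derivatives and the fundamental theorem of calculus -/

/-- The mean of `u` over `[s, s + δ]` with the weight `smoothTransition' (· / δ)`. -/
theorem integral_deriv_smoothTransition_smul {X : Type*} [NormedAddCommGroup X] [NormedSpace ℝ X]
    {T s δ : ℝ} (hδ : 0 < δ) (hs : 0 < s) (hsT : s + δ < T) (u : ℝ → X) :
    ∫ x in (0 : ℝ)..T, (δ⁻¹ * deriv Real.smoothTransition ((x - s) / δ)) • u x =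
      ∫ y in (0 : ℝ)..1, deriv Real.smoothTransition y • u (s + δ * y) := by
  have h0 : ∀ y < 0, deriv Real.smoothTransition y = 0 := fun y hy => by
    have : Real.smoothTransition =ᶠ[𝓝 y] fun _ => 0 := by
      filter_upwards [Iio_mem_nhds hy] with z hz
      exact Real.smoothTransition.zero_of_nonpos (le_of_lt hz)
    simp [this.deriv_eq]
  have h1 : ∀ y > 1, deriv Real.smoothTransition y = 0 := fun y hy => by
    have : Real.smoothTransition =ᶠ[𝓝 y] fun _ => 1 := by
      filter_upwards [Ioi_mem_nhds hy] with z hz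
      exact Real.smoothTransition.one_of_one_le (le_of_lt hz)
    simp [this.deriv_eq]
  set F : ℝ → X := fun x => (δ⁻¹ * deriv Real.smoothTransition ((x - s) / δ)) • u x with hF
  have hsupp : ∫ x in (0 : ℝ)..T, F x = ∫ x in s..(s + δ), F x := by
    rw [intervalIntegral.integral_of_le (by linarith), intervalIntegral.integral_of_le (by linarith),
      ← integral_Icc_eq_integral_Ioc, ← integral_Icc_eq_integral_Ioc]
    refine (setIntegral_eq_of_subset_of_forall_sdiff_eq_zero measurableSet_Icc
      (Icc_subset_Icc hs.le hsT.le) ?_)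
    intro x hx
    have : x < s ∨ s + δ < x := by
      by_contra! h
      exact hx.2 ⟨h.1, h.2⟩
    rcases this with h | h
    · simp [hF, h0 _ (div_neg_of_neg_of_pos (sub_neg.2 h) hδ)]
    · simp [hF, h1 ((x - s) / δ) ((one_lt_div hδ).2 (by linarith))]
  rw [hsupp]
  have := intervalIntegral.smul_integral_comp_add_mul (a := 0) (b := 1) F δ s
  simp only [mul_zero, add_zero, mul_one] at this
  rw [← this, ← intervalIntegral.integral_smul]
  refine intervalIntegral.integral_congr fun y _ => ?_
  simp only [hF, add_sub_cancel_left, smul_smul]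
  congr 1
  field_simp

/-- The integral is continuous in `δ`, and at `δ = 0` the weight has total mass `1 - 0 = 1`. -/
theorem tendsto_integral_deriv_smoothTransition_smul {X : Type*} [NormedAddCommGroup X]
    [NormedSpace ℝ X] [CompleteSpace X] {u : ℝ → X} (hu : Continuous u) (s : ℝ) :
    Tendsto (fun δ : ℝ => ∫ y in (0 : ℝ)..1, deriv Real.smoothTransition y • u (s + δ * y))
      (𝓝 0) (𝓝 (u s)) := by
  have hd : Continuous (deriv Real.smoothTransition) :=
    (Real.smoothTransition.contDiff (n := 1)).continuous_deriv le_rfl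
  have hc : Continuous fun δ : ℝ =>
      ∫ y in (0 : ℝ)..1, deriv Real.smoothTransition y • u (s + δ * y) := by
    apply intervalIntegral.continuous_parametric_intervalIntegral_of_continuous' 
    fun_prop
  have h0 := hc.tendsto 0
  have : ∫ y in (0 : ℝ)..1, deriv Real.smoothTransition y • u (s + 0 * y) = u s := by
    simp only [zero_mul, add_zero]
    rw [intervalIntegral.integral_smul_const, intervalIntegral.integral_deriv_eq_sub]
    · simp
    · intro x _
      exact (Real.smoothTransition.contDiff (n := 1)).differentiable (by simp) x
    · exact hd.intervalIntegrable _ _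
  rwa [this] at h0

/-- Test with a smooth plateau that rises on `[s, s + δ]` and falls on `[t, t + δ]`. Its derivative
averages `u` near `s` and near `t`, and the plateau itself tends to the indicator of `(s, t]` as `δ
→ 0`. -/
theorem IsWeakTimeDeriv.sub_eq_integral {X : Type*} [NormedAddCommGroup X] [NormedSpace ℝ X]
    [CompleteSpace X] {T : ℝ} {u u' : ℝ → X} (hu : ContinuousOn u (Icc 0 T))
    (h : IsWeakTimeDeriv T u u') {s t : ℝ} (hs : 0 < s) (hst : s ≤ t) (ht : t < T) :
    IntervalIntegrable u' volume s t ∧ u t - u s = ∫ r in s..t, u' r := by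
  have hT : 0 ≤ T := by linarith
  obtain ⟨b, htb, hbT⟩ := exists_between ht
  obtain ⟨a, ha0, has⟩ := exists_between hs
  have hint : IntegrableOn u' (Ioo a b) := by
    have := h.memLp_loc a b ha0 hbT
    exact this.integrable (by norm_num)
  have hint' : IntervalIntegrable u' volume s t :=
    (intervalIntegrable_iff_integrableOn_Ioc_of_le hst).2
      (hint.mono_set fun x hx => ⟨by linarith [hx.1], by linarith [hx.2]⟩)
  refine ⟨hint', ?_⟩
  -- Constant extension beyond `[0, T]`, since the averaging limit is stated for functions
  -- continuous on the whole line.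
  set v : ℝ → X := IccExtend hT ((Icc (0 : ℝ) T).domRestrict u) with hv
  have hvc : Continuous v := (continuousOn_iff_continuous_domRestrict.1 hu).Icc_extend'
  have hvu : ∀ x ∈ Icc 0 T, v x = u x := fun x hx => by
    rw [hv, IccExtend_of_mem _ _ hx, Set.domRestrict_apply]
  have hθ := Real.smoothTransition.contDiff (n := ⊤)
  set η : ℝ → ℝ → ℝ := fun δ x =>
    Real.smoothTransition ((x - s) / δ) - Real.smoothTransition ((x - t) / δ) with hη
  have hderiv : ∀ δ x, deriv (η δ) x = δ⁻¹ * deriv Real.smoothTransition ((x - s) / δ) -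
      δ⁻¹ * deriv Real.smoothTransition ((x - t) / δ) := by
    intro δ x
    have hd : ∀ r : ℝ, HasDerivAt (fun x => Real.smoothTransition ((x - r) / δ))
        (deriv Real.smoothTransition ((x - r) / δ) * (1 / δ)) x := fun r => by
      have h1 : HasDerivAt (fun x : ℝ => (x - r) / δ) (1 / δ) x :=
        ((hasDerivAt_id x).sub_const r).div_const δ
      exact ((hθ.differentiable (by simp)) ((x - r) / δ)).hasDerivAt.comp x h1
    refine ((hd s).sub (hd t)).deriv.trans ?_
    ring
  have hzero : ∀ δ > 0, ∀ x, x ∉ Ioo s (t + δ) → η δ x = 0 := by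
    intro δ hδ x hx
    rcases le_or_gt x s with h1 | h1
    · simp only [hη]
      rw [Real.smoothTransition.zero_of_nonpos (div_nonpos_of_nonpos_of_nonneg (by linarith) hδ.le),
        Real.smoothTransition.zero_of_nonpos (div_nonpos_of_nonpos_of_nonneg (by linarith) hδ.le),
        sub_zero]
    · have h2 : t + δ ≤ x := by
        by_contra! h2
        exact hx ⟨h1, h2⟩
      simp only [hη]
      rw [Real.smoothTransition.one_of_one_le ((one_le_div hδ).2 (by linarith)),
        Real.smoothTransition.one_of_one_le ((one_le_div hδ).2 (by linarith)), sub_self]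
  have hbound : ∀ δ x, |η δ x| ≤ 1 := fun δ x => by
    rw [abs_le]
    constructor <;> simp only [hη] <;>
      linarith [Real.smoothTransition.nonneg ((x - s) / δ), Real.smoothTransition.le_one ((x - s) / δ),
        Real.smoothTransition.nonneg ((x - t) / δ), Real.smoothTransition.le_one ((x - t) / δ)]
  have hsmooth : ∀ δ, ContDiff ℝ ∞ (η δ) := fun δ => by
    simp only [hη]
    exact (hθ.comp (by fun_prop)).sub (hθ.comp (by fun_prop))
  have hev : ∀ᶠ δ : ℝ in 𝓝[>] 0, 0 < δ ∧ t + δ < b := by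
    filter_upwards [self_mem_nhdsWithin,
      mem_nhdsWithin_of_mem_nhds (Iio_mem_nhds (sub_pos.2 htb))] with δ h1 h2
    exact ⟨h1, by simp only [mem_Iio] at h2; linarith⟩
  have hts : ∀ δ > 0, t + δ < b → tsupport (η δ) ⊆ Icc s (t + δ) := fun δ hδ _ =>
    closure_minimal (fun x hx => by
      by_contra hc
      exact hx (hzero δ hδ x fun hx' => hc (Ioo_subset_Icc_self hx'))) isClosed_Icc
  have hLHS : ∀ᶠ δ : ℝ in 𝓝[>] 0, ∫ r in Ioo 0 T, deriv (η δ) r • u r =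
      (∫ y in (0 : ℝ)..1, deriv Real.smoothTransition y • v (s + δ * y)) -
      ∫ y in (0 : ℝ)..1, deriv Real.smoothTransition y • v (t + δ * y) := by
    filter_upwards [hev] with δ ⟨hδ, hδb⟩
    rw [← integral_deriv_smoothTransition_smul hδ hs (by linarith : s + δ < T) v,
      ← integral_deriv_smoothTransition_smul hδ (hs.trans_le hst) (by linarith : t + δ < T) v]
    have hcd : Continuous (deriv Real.smoothTransition) :=
      (Real.smoothTransition.contDiff (n := 1)).continuous_deriv le_rfl
    rw [← intervalIntegral.integral_sub, intervalIntegral.integral_of_le hT,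
      integral_Ioc_eq_integral_Ioo]
    · refine setIntegral_congr_fun measurableSet_Ioo fun x hx => ?_
      simp only [hderiv, hvu x (Ioo_subset_Icc_self hx), sub_smul]
    · exact (by fun_prop : Continuous fun x =>
        (δ⁻¹ * deriv Real.smoothTransition ((x - s) / δ)) • v x).intervalIntegrable _ _
    · exact (by fun_prop : Continuous fun x =>
        (δ⁻¹ * deriv Real.smoothTransition ((x - t) / δ)) • v x).intervalIntegrable _ _
  have hlim1 : Tendsto (fun δ : ℝ => ∫ r in Ioo 0 T, deriv (η δ) r • u r) (𝓝[>] 0)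
      (𝓝 (u s - u t)) := by
    rw [tendsto_congr' hLHS, ← hvu s ⟨hs.le, by linarith⟩, ← hvu t ⟨by linarith, ht.le⟩]
    exact (((tendsto_integral_deriv_smoothTransition_smul hvc s).sub
      (tendsto_integral_deriv_smoothTransition_smul hvc t)).mono_left nhdsWithin_le_nhds)
  have hlim2 : Tendsto (fun δ : ℝ => ∫ r in Ioo a b, η δ r • u' r) (𝓝[>] 0)
      (𝓝 (∫ r in Ioo a b, (Ioc s t).indicator (fun _ => (1 : ℝ)) r • u' r)) := by
    refine tendsto_integral_filter_of_dominated_convergence (fun r => ‖u' r‖) ?_ ?_ hint.norm ?_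
    · exact .of_forall fun δ => (hsmooth δ).continuous.aestronglyMeasurable.smul hint.1
    · refine .of_forall fun δ => .of_forall fun r => ?_
      rw [norm_smul]
      exact mul_le_of_le_one_left (norm_nonneg _) (hbound δ r)
    · refine .of_forall fun r => ?_
      apply Tendsto.smul_const
      apply tendsto_const_nhds.congr'
      -- At fixed `r` the smooth step is eventually constant in `δ`. It is `0` at `r = q`, hence the
      -- half-open interval `(s, t]` in the limit.
      have key : ∀ q : ℝ, ∀ᶠ δ : ℝ in 𝓝[>] 0,
          Real.smoothTransition ((r - q) / δ) = if q < r then 1 else 0 := by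
        intro q
        split_ifs with hq
        · filter_upwards [self_mem_nhdsWithin,
            mem_nhdsWithin_of_mem_nhds (Iio_mem_nhds (sub_pos.2 hq))] with δ h1 h2
          exact Real.smoothTransition.one_of_one_le ((one_le_div h1).2 (le_of_lt h2))
        · filter_upwards [self_mem_nhdsWithin] with δ h1
          exact Real.smoothTransition.zero_of_nonpos
            (div_nonpos_of_nonpos_of_nonneg (by linarith) (le_of_lt h1))
      filter_upwards [key s, key t] with δ h1 h2
      simp only [hη, h1, h2, indicator, mem_Ioc]
      split_ifs <;> first | (norm_num; done) | (exfalso; grind)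
  have hRHS : ∀ᶠ δ : ℝ in 𝓝[>] 0, ∫ r in Ioo 0 T, deriv (η δ) r • u r =
      - ∫ r in Ioo a b, η δ r • u' r := by
    filter_upwards [hev] with δ ⟨hδ, hδb⟩
    have hsub := hts δ hδ hδb
    rw [h.integral_eq (η δ) (hsmooth δ)
      (HasCompactSupport.of_support_subset_isCompact isCompact_Icc
        ((subset_tsupport _).trans hsub))
      (hsub.trans fun x hx => ⟨by linarith [hx.1], by linarith [hx.2]⟩)]
    congr 1
    refine setIntegral_eq_of_subset_of_forall_sdiff_eq_zero measurableSet_Ioo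
      (Ioo_subset_Ioo ha0.le hbT.le) fun x hx => ?_
    rw [hzero δ hδ x (fun hx' => hx.2 ⟨by linarith [hx'.1], by linarith [hx'.2]⟩), zero_smul]
  have hfin := tendsto_nhds_unique (hlim1.congr' hRHS) hlim2.neg
  have hind : ∫ r in Ioo a b, (Ioc s t).indicator (fun _ => (1 : ℝ)) r • u' r =
      ∫ r in s..t, u' r := by
    rw [intervalIntegral.integral_of_le hst]
    have : (fun r => (Ioc s t).indicator (fun _ => (1 : ℝ)) r • u' r) = (Ioc s t).indicator u' := by
      funext r
      by_cases hr : r ∈ Ioc s t <;> simp [hr]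
    rw [this, setIntegral_indicator measurableSet_Ioc, inter_eq_self_of_subset_right]
    exact fun x hx => ⟨by linarith [hx.1], by linarith [hx.2]⟩
  rw [hind] at hfin
  rw [← neg_sub, hfin, neg_neg]

/-! ### Energy inequality and Grönwall's inequality -/

theorem le_of_forall_le_of_sub_lt {Ψ : ℝ → ℝ} {a b δ : ℝ} (hδ : 0 < δ)
    (h : ∀ s t, a ≤ s → s ≤ t → t ≤ b → t - s < δ → Ψ s ≤ Ψ t) (hab : a ≤ b) : Ψ a ≤ Ψ b := by
  have key : ∀ n : ℕ, ∀ t, a ≤ t → t ≤ b → t - a < (n + 1) * δ → Ψ a ≤ Ψ t := by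
    intro n
    induction n with
    | zero => intro t h1 h2 h3; exact h a t le_rfl h1 h2 (by simpa using h3)
    | succ n ih =>
      intro t h1 h2 h3
      push_cast at h3
      rcases le_or_gt (t - δ / 2) a with h4 | h4
      · exact h a t le_rfl h1 h2 (by linarith)
      · obtain ⟨s, hs1, hs2⟩ : ∃ s, max a (t - δ) < s ∧ s < min t (a + (n + 1) * δ) := by
          refine exists_between (max_lt (lt_min ?_ ?_) (lt_min ?_ ?_))
          · linarith
          · have : (0 : ℝ) ≤ n := n.cast_nonneg
            nlinarith
          · linarith
          · linarith
        have := max_lt_iff.1 hs1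
        have := lt_min_iff.1 hs2
        exact (ih s (by linarith) (by linarith) (by linarith)).trans
          (h s t (by linarith) (by linarith) h2 (by linarith))
  obtain ⟨n, hn⟩ := exists_nat_gt ((b - a) / δ)
  refine key n b hab le_rfl ?_
  have := (div_lt_iff₀ hδ).1 hn
  linarith

/-- The identity `‖w t‖² - ‖w s‖² = ∫ ⟨w t + w s, w'⟩` avoids differentiating `‖w‖²`. On short
intervals uniform continuity replaces `w t + w s` by `2 w r` at a cost of `2ε ‖w' r‖`. The short
intervals are chained by `le_of_forall_le_of_sub_lt`, and `ε` is arbitrary. -/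
theorem sq_norm_sub_sq_norm_le {H : Type*} [NormedAddCommGroup H] [InnerProductSpace ℝ H]
    [CompleteSpace H] {w w' : ℝ → H} {a b c : ℝ} (hab : a ≤ b) (hw : ContinuousOn w (Icc a b))
    (hint : IntervalIntegrable w' volume a b)
    (hftc : ∀ s t, a ≤ s → s ≤ t → t ≤ b → w t - w s = ∫ r in s..t, w' r)
    (hd : ∀ᵐ r ∂(volume.restrict (Ioc a b)), inner ℝ (w' r) (w r) ≤ c * ‖w r‖ ^ 2) :
    ‖w b‖ ^ 2 - ‖w a‖ ^ 2 ≤ ∫ r in a..b, 2 * c * ‖w r‖ ^ 2 := by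
  have hw2 : ContinuousOn (fun r => 2 * c * ‖w r‖ ^ 2) (Icc a b) := by fun_prop
  have hI : ∀ s t, a ≤ s → s ≤ t → t ≤ b → IntervalIntegrable w' volume s t :=
    fun s t h1 h2 h3 => hint.mono_set (by
      rw [uIcc_of_le h2, uIcc_of_le hab]; exact Icc_subset_Icc h1 h3)
  have hJ : ∀ s t, a ≤ s → s ≤ t → t ≤ b →
      IntervalIntegrable (fun r => 2 * c * ‖w r‖ ^ 2) volume s t :=
    fun s t h1 h2 h3 => (hw2.mono (by
      rw [uIcc_of_le h2]; exact Icc_subset_Icc h1 h3)).intervalIntegrable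
  have hN : 0 ≤ ∫ r in a..b, ‖w' r‖ :=
    intervalIntegral.integral_nonneg hab fun _ _ => norm_nonneg _
  refine le_of_forall_pos_le_add fun ε' hε' => ?_
  obtain ⟨ε, hε, hεN⟩ : ∃ ε > 0, 2 * ε * ∫ r in a..b, ‖w' r‖ ≤ ε' := by
    refine ⟨ε' / (2 * ((∫ r in a..b, ‖w' r‖) + 1)), by positivity, ?_⟩
    rw [mul_div_assoc', div_mul_eq_mul_div, div_le_iff₀ (by positivity)]
    nlinarith
  obtain ⟨δ, hδ, hunif⟩ := Metric.uniformContinuousOn_iff.1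
    (isCompact_Icc.uniformContinuousOn_of_continuous hw) ε hε
  have hadd : ∀ F : ℝ → ℝ, (∀ s t, a ≤ s → s ≤ t → t ≤ b → IntervalIntegrable F volume s t) →
      ∀ s t, a ≤ s → s ≤ t → t ≤ b →
        (∫ r in a..t, F r) - ∫ r in a..s, F r = ∫ r in s..t, F r := fun F hF s t h1 h2 h3 => by
    rw [← intervalIntegral.integral_add_adjacent_intervals (hF a s le_rfl h1 (h2.trans h3))
      (hF s t h1 h2 h3)]
    ring
  -- `Ψ` is the primitive of the bound plus the accumulated error, minus `‖w‖²`; the inequality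
  -- sought says that `Ψ` grows on short intervals.
  have key := le_of_forall_le_of_sub_lt hδ (a := a) (b := b)
    (Ψ := fun t => (∫ r in a..t, 2 * c * ‖w r‖ ^ 2) + 2 * ε * (∫ r in a..t, ‖w' r‖) - ‖w t‖ ^ 2)
    (fun s t h1 h2 h3 h4 => by
      have e1 := hadd _ hJ s t h1 h2 h3
      have e2 := hadd _ (fun s t h1 h2 h3 => (hI s t h1 h2 h3).norm) s t h1 h2 h3
      have e3 : ‖w t‖ ^ 2 - ‖w s‖ ^ 2 = ∫ r in s..t, inner ℝ (w t + w s) (w' r) := by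
        have hcomm := ((innerSL ℝ) (w t + w s)).intervalIntegral_comp_comm (hI s t h1 h2 h3)
        simp only [innerSL_apply_apply] at hcomm
        rw [hcomm, ← hftc s t h1 h2 h3, inner_add_left, inner_sub_right, inner_sub_right,
          real_inner_self_eq_norm_sq, real_inner_self_eq_norm_sq, real_inner_comm (w s) (w t)]
        ring
      have e4 : ∫ r in s..t, inner ℝ (w t + w s) (w' r) ≤
          ∫ r in s..t, (2 * c * ‖w r‖ ^ 2 + 2 * ε * ‖w' r‖) := by
        refine intervalIntegral.integral_mono_ae_restrict h2 ?_
          ((hJ s t h1 h2 h3).add ((hI s t h1 h2 h3).norm.const_mul _)) ?_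
        · have := ((hI s t h1 h2 h3))
          exact ⟨((innerSL ℝ) (w t + w s)).integrable_comp this.1,
            ((innerSL ℝ) (w t + w s)).integrable_comp this.2⟩
        · have hd' : ∀ᵐ r ∂(volume.restrict (Icc s t)), inner ℝ (w' r) (w r) ≤ c * ‖w r‖ ^ 2 := by
            rw [Measure.restrict_congr_set Ioc_ae_eq_Icc] at hd
            exact ae_restrict_of_ae_restrict_of_subset (Icc_subset_Icc h1 h3) hd
          filter_upwards [hd', ae_restrict_mem measurableSet_Icc] with r hr hmem
          have hrm : r ∈ Icc a b := ⟨h1.trans hmem.1, hmem.2.trans h3⟩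
          have n1 : ‖w t - w r‖ ≤ ε := by
            rw [← dist_eq_norm]
            refine (hunif t ⟨by linarith, h3⟩ r hrm ?_).le
            rw [Real.dist_eq, abs_of_nonneg (by linarith [hmem.2])]
            linarith [hmem.1]
          have n2 : ‖w s - w r‖ ≤ ε := by
            rw [← dist_eq_norm]
            refine (hunif s ⟨h1, by linarith⟩ r hrm ?_).le
            rw [dist_comm, Real.dist_eq, abs_of_nonneg (by linarith [hmem.1])]
            linarith [hmem.2]
          have n3 : inner ℝ (w t + w s) (w' r) = 2 * inner ℝ (w' r) (w r) +
              inner ℝ (w t - w r) (w' r) + inner ℝ (w s - w r) (w' r) := by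
            rw [real_inner_comm (w r) (w' r)]
            simp only [inner_add_left, inner_sub_left]
            ring
          have n4 := (real_inner_le_norm (w t - w r) (w' r)).trans
            (mul_le_mul_of_nonneg_right n1 (norm_nonneg _))
          have n5 := (real_inner_le_norm (w s - w r) (w' r)).trans
            (mul_le_mul_of_nonneg_right n2 (norm_nonneg _))
          simp only [n3]
          linarith
      rw [intervalIntegral.integral_add (hJ s t h1 h2 h3) ((hI s t h1 h2 h3).norm.const_mul _),
        intervalIntegral.integral_const_mul (2 * ε)] at e4
      rw [← e1, ← e2, ← e3] at e4
      linarith) hab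
  simp only [intervalIntegral.integral_same] at key
  linarith

/-- Grönwall's inequality in integral form on the open interval, for a continuous function. -/
theorem le_exp_mul_of_sub_le_integral {y : ℝ → ℝ} {T K : ℝ} (hy : ContinuousOn y (Icc 0 T))
    (h : ∀ s t, 0 < s → s ≤ t → t < T → y t - y s ≤ ∫ r in s..t, K * y r) :
    ∀ t ∈ Icc 0 T, y t ≤ Real.exp (K * t) * y 0 := by
  have key : ∀ s t, 0 < s → s ≤ t → t < T → y t ≤ Real.exp (K * (t - s)) * y s := by
    intro s t hs hst ht
    have hys : ContinuousOn y (Icc s t) := hy.mono (Icc_subset_Icc hs.le ht.le)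
    have := le_gronwallBound_of_liminf_deriv_right_le (f := y) (f' := fun x => K * y x)
      (δ := y s) (K := K) (ε := 0) (a := s) (b := t) hys ?_ le_rfl (fun x _ => by simp)
      t ⟨hst, le_rfl⟩
    · rwa [gronwallBound_ε0, mul_comm] at this
    · intro x hx r hr
      have hx0 : 0 < x := hs.trans_le hx.1
      have hcont : ContinuousAt (fun r => K * y r) x :=
        ((hy.continuousAt (Icc_mem_nhds hx0 (hx.2.trans ht))).const_mul K)
      have hderiv : HasDerivAt (fun z => ∫ r in x..z, K * y r) (K * y x) x := by
        refine intervalIntegral.integral_hasDerivAt_right IntervalIntegrable.refl ?_ hcont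
        have hc : ContinuousOn (fun r => K * y r) (Ioo 0 T) :=
          (hy.mono Ioo_subset_Icc_self).const_mul K
        exact hc.stronglyMeasurableAtFilter isOpen_Ioo x ⟨hx0, hx.2.trans ht⟩
      -- `y` need not be differentiable: to the right of `x` its slopes are at most those of `∫ K
      -- y`, which tend to `K y x`.
      have hslope := (hasDerivAt_iff_tendsto_slope.1 hderiv).mono_left
        (nhdsWithin_mono x fun z (hz : x < z) => ne_of_gt hz)
      refine Eventually.frequently ?_
      filter_upwards [hslope.eventually (gt_mem_nhds hr), self_mem_nhdsWithin,
        mem_nhdsWithin_of_mem_nhds (Iio_mem_nhds (hx.2.trans ht))] with z hz hxz hzT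
      have hxz' : x < z := hxz
      refine lt_of_le_of_lt ?_ hz
      rw [slope_def_field, intervalIntegral.integral_same, sub_zero, div_eq_inv_mul]
      exact mul_le_mul_of_nonneg_left (h x z hx0 hxz'.le hzT)
        (inv_nonneg.2 (sub_nonneg.2 hxz'.le))
  intro t ht
  rcases ht.1.eq_or_lt with h0 | h0
  · simp [← h0]
  have hT : 0 < T := h0.trans_le ht.2
  have step : ∀ t, 0 < t → t < T → y t ≤ Real.exp (K * t) * y 0 := by
    intro t h0 ht
    have hlim : Tendsto (fun s => Real.exp (K * (t - s)) * y s) (𝓝[>] 0)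
        (𝓝 (Real.exp (K * (t - 0)) * y 0)) := by
      refine Tendsto.mul ((Continuous.tendsto (by fun_prop) 0).mono_left nhdsWithin_le_nhds) ?_
      have := (hy 0 ⟨le_rfl, hT.le⟩)
      exact this.tendsto.mono_left (by
        rw [← nhdsWithin_Ioo_eq_nhdsGT hT]
        exact nhdsWithin_mono _ Ioo_subset_Icc_self)
    rw [sub_zero] at hlim
    refine ge_of_tendsto hlim ?_
    filter_upwards [self_mem_nhdsWithin, mem_nhdsWithin_of_mem_nhds (Iio_mem_nhds h0)] with s h1 h2
    exact key s t h1 (le_of_lt h2) ht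
  rcases ht.2.eq_or_lt with h1 | h1
  · have hm : 𝓝[<] t ≤ 𝓝[Icc 0 T] t := by
      rw [← nhdsWithin_Ioo_eq_nhdsLT h0]
      exact nhdsWithin_mono _ (h1 ▸ Ioo_subset_Icc_self)
    refine le_of_tendsto_of_tendsto ((hy t ht).tendsto.mono_left hm)
      ((Continuous.tendsto (f := fun t => Real.exp (K * t) * y 0) (by fun_prop) t).mono_left
        nhdsWithin_le_nhds) ?_
    filter_upwards [self_mem_nhdsWithin, mem_nhdsWithin_of_mem_nhds (Ioi_mem_nhds h0)] with s h2 h3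
    exact step s h3 (h1 ▸ h2)
  · exact step t h0 h1

/-- Grönwall is applied to `‖u - v‖²` with constant `2c`; the square root halves the exponent. -/
theorem IsWeakTimeDeriv.norm_sub_le {H : Type*} [NormedAddCommGroup H] [InnerProductSpace ℝ H]
    [CompleteSpace H] {u v u' v' : ℝ → H} {T c : ℝ} (hu : ContinuousOn u (Icc 0 T))
    (hv : ContinuousOn v (Icc 0 T)) (hu' : IsWeakTimeDeriv T u u') (hv' : IsWeakTimeDeriv T v v')
    (hd : ∀ᵐ r ∂(volume.restrict (Ioo 0 T)),
      inner ℝ (u' r - v' r) (u r - v r) ≤ c * ‖u r - v r‖ ^ 2) :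
    ∀ t ∈ Icc 0 T, ‖u t - v t‖ ≤ Real.exp (c * t) * ‖u 0 - v 0‖ := by
  have hy : ContinuousOn (fun t => ‖u t - v t‖ ^ 2) (Icc 0 T) := by fun_prop
  intro t ht
  have := le_exp_mul_of_sub_le_integral (K := 2 * c) hy (fun s t hs hst ht => ?_) t ht
  · refine abs_le_of_sq_le_sq' ?_ (by positivity) |>.2
    refine this.trans_eq ?_
    rw [mul_pow, ← Real.exp_nat_mul]
    ring_nf
  · have hsub : Icc s t ⊆ Ioo 0 T := fun x hx => ⟨hs.trans_le hx.1, hx.2.trans_lt ht⟩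
    refine sq_norm_sub_sq_norm_le (w := fun r => u r - v r) (w' := fun r => u' r - v' r) hst
      ((hu.sub hv).mono (hsub.trans Ioo_subset_Icc_self))
      ((hu'.sub_eq_integral hu hs hst ht).1.sub (hv'.sub_eq_integral hv hs hst ht).1) ?_
      (ae_restrict_of_ae_restrict_of_subset (Ioc_subset_Icc_self.trans hsub) hd)
    intro a b h1 h2 h3
    obtain ⟨i1, e1⟩ := hu'.sub_eq_integral hu (hs.trans_le h1) h2 (h3.trans_lt ht)
    obtain ⟨i2, e2⟩ := hv'.sub_eq_integral hv (hs.trans_le h1) h2 (h3.trans_lt ht)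
    rw [intervalIntegral.integral_sub i1 i2, ← e1, ← e2]
    abel

/-! ### Test functions, representatives and the chain rule in `W` -/

theorem tendsto_eLpNorm_zero_of_dominated {α E : Type*} {m : MeasurableSpace α} {μ : Measure α}
    [NormedAddCommGroup E] {q : ℝ≥0∞} (hq0 : q ≠ 0) (hq : q ≠ ⊤) {D : ℕ → α → E} {g : α → ℝ}
    (hD : ∀ n, AEStronglyMeasurable (D n) μ) (hg : MemLp g q μ)
    (hbound : ∀ n, ∀ᵐ x ∂μ, ‖D n x‖ ≤ g x)
    (hlim : ∀ᵐ x ∂μ, Tendsto (fun n => D n x) atTop (𝓝 0)) :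
    Tendsto (fun n => eLpNorm (D n) q μ) atTop (𝓝 0) := by
  have hr : 0 < q.toReal := ENNReal.toReal_pos hq0 hq
  simp_rw [eLpNorm_eq_lintegral_rpow_enorm_toReal hq0 hq]
  have key : Tendsto (fun n => ∫⁻ x, ‖D n x‖ₑ ^ q.toReal ∂μ) atTop (𝓝 (∫⁻ _, 0 ∂μ)) := by
    refine tendsto_lintegral_of_dominated_convergence' (fun x => ‖g x‖ₑ ^ q.toReal)
      (fun n => (hD n).enorm.pow_const _) (fun n => ?_) ?_ ?_
    · filter_upwards [hbound n] with x hx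
      exact ENNReal.rpow_le_rpow (enorm_le_iff_norm_le.2 (hx.trans (le_abs_self _))) hr.le
    · exact (lintegral_rpow_enorm_lt_top_of_eLpNorm_lt_top hq0 hq hg.2).ne
    · filter_upwards [hlim] with x hx
      have h1 : Tendsto (fun n => ‖D n x‖ₑ) atTop (𝓝 0) := by
        simpa using hx.enorm
      have := (ENNReal.continuous_rpow_const (y := q.toReal)).tendsto 0 |>.comp h1
      simpa [ENNReal.zero_rpow_of_pos hr, Function.comp_def] using this
  rw [lintegral_zero] at key
  have := (ENNReal.continuous_rpow_const (y := 1 / q.toReal)).tendsto 0 |>.comp key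
  simpa [ENNReal.zero_rpow_of_pos (inv_pos.2 hr), Function.comp_def] using this

theorem weighted_absolutelyContinuous {n : ℕ} (ρ : Space n → ℝ) :
    weighted ρ ≪ (volume : Measure (Space n)) :=
  withDensity_absolutelyContinuous _ _

theorem IsTest.continuous_gradient {n : ℕ} {φ : Space n → ℝ} (hφ : IsTest φ) :
    Continuous (gradient φ) :=
  (LinearIsometryEquiv.continuous _).comp (hφ.1.continuous_fderiv (by simp))

theorem IsTest.sub {n : ℕ} {φ ψ : Space n → ℝ} (hφ : IsTest φ) (hψ : IsTest ψ) :
    IsTest (fun x => φ x - ψ x) :=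
  ⟨hφ.1.sub hψ.1, hφ.2.sub hψ.2⟩

theorem IsTest.gradient_sub {n : ℕ} {φ ψ : Space n → ℝ} (hφ : IsTest φ) (hψ : IsTest ψ)
    (x : Space n) : gradient (fun x => φ x - ψ x) x = gradient φ x - gradient ψ x := by
  simp only [gradient]
  rw [fderiv_fun_sub (hφ.1.differentiable (by simp) x) (hψ.1.differentiable (by simp) x), map_sub]

theorem IsTest.comp {n : ℕ} {φ : Space n → ℝ} (hφ : IsTest φ) {h : ℝ → ℝ} (hh : ContDiff ℝ ∞ h)
    (h0 : h 0 = 0) : IsTest (fun x => h (φ x)) :=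
  ⟨hh.comp hφ.1, hφ.2.comp_left h0⟩

theorem IsTest.gradient_comp {n : ℕ} {φ : Space n → ℝ} (hφ : IsTest φ) {h : ℝ → ℝ}
    (hh : ContDiff ℝ ∞ h) (x : Space n) :
    gradient (fun x => h (φ x)) x = deriv h (φ x) • gradient φ x := by
  have h1 := (hh.differentiable (by simp) (φ x)).hasDerivAt
  have h2 := (hφ.1.differentiable (by simp) x).hasFDerivAt
  simp only [gradient]
  rw [show fderiv ℝ (fun x => h (φ x)) x = deriv h (φ x) • fderiv ℝ φ x from
    (h1.comp_hasFDerivAt x h2).fderiv, map_smul]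

section

variable {n : ℕ} {p : ℝ} [Fact (2 ≤ p)] {σ β : Space n → ℝ}

theorem W.Represents.exists_ae_tendsto {w : W n p σ β} {u : L2 n} (h : W.Represents w u) :
    ∃ φ : ℕ → Space n → ℝ, (∀ m, IsTest (φ m)) ∧
      Tendsto (fun m => eLpNorm (fun x => gradient (φ m) x - w.1.fst x)
        (ENNReal.ofReal p) (weighted σ)) atTop (𝓝 0) ∧
      Tendsto (fun m => eLpNorm (fun x => φ m x - w.1.snd x) 2 (weighted β)) atTop (𝓝 0) ∧
      Tendsto (fun m => eLpNorm (fun x => φ m x - u x) 2 volume) atTop (𝓝 0) ∧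
      ∀ᵐ x, Tendsto (fun m => φ m x) atTop (𝓝 (u x)) := by
  obtain ⟨φ, hφ, h1, h2⟩ := h
  have hm := tendstoInMeasure_of_tendsto_eLpNorm (by norm_num : (2 : ℝ≥0∞) ≠ 0)
    (fun m => (hφ m).1.continuous.aestronglyMeasurable) (Lp.aestronglyMeasurable u) h2
  obtain ⟨ns, hns, hae⟩ := hm.exists_seq_tendsto_ae
  refine ⟨fun m => φ (ns m), fun m => hφ _, ?_, ?_, h2.comp hns.tendsto_atTop, hae⟩
  · exact tendsto_of_tendsto_of_tendsto_of_le_of_le tendsto_const_nhds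
      (h1.comp hns.tendsto_atTop) (fun _ => zero_le) (fun _ => le_self_add)
  · exact tendsto_of_tendsto_of_tendsto_of_le_of_le tendsto_const_nhds
      (h1.comp hns.tendsto_atTop) (fun _ => zero_le) (fun _ => le_add_self)

/-- One approximating sequence converges to both functions, and `weighted β ≪ volume`, so the a.e.
limits of a common subsequence agree. -/
theorem W.Represents.snd_ae_eq {w : W n p σ β} {u : L2 n} (h : W.Represents w u) :
    w.1.snd =ᵐ[weighted β] u := by
  obtain ⟨φ, hφ, -, h1, -, h2⟩ := h.exists_ae_tendsto
  have hm := tendstoInMeasure_of_tendsto_eLpNorm (by norm_num : (2 : ℝ≥0∞) ≠ 0)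
    (fun m => (hφ m).1.continuous.aestronglyMeasurable) (Lp.aestronglyMeasurable w.1.snd) h1
  obtain ⟨ns, hns, hae⟩ := hm.exists_seq_tendsto_ae
  filter_upwards [hae, (weighted_absolutelyContinuous β).ae_le h2] with x hx1 hx2
  exact tendsto_nhds_unique hx1 (hx2.comp hns.tendsto_atTop)

theorem W.exists_represents_of_tendsto {φ : ℕ → Space n → ℝ} (hφ : ∀ m, IsTest (φ m))
    (G : Lp (Space n) (ENNReal.ofReal p) (weighted σ)) (b : Lp ℝ 2 (weighted β)) (u : L2 n)
    (h1 : Tendsto (fun m => eLpNorm (fun x => gradient (φ m) x - G x)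
      (ENNReal.ofReal p) (weighted σ)) atTop (𝓝 0))
    (h2 : Tendsto (fun m => eLpNorm (fun x => φ m x - b x) 2 (weighted β)) atTop (𝓝 0))
    (h3 : Tendsto (fun m => eLpNorm (fun x => φ m x - u x) 2 volume) atTop (𝓝 0)) :
    ∃ z : W n p σ β, z.1.fst = G ∧ z.1.snd = b ∧ W.Represents z u := by
  -- Nothing is assumed on `σ` and `β` here; the tail of the sequence lies in the weighted spaces
  -- because it is at finite distance from `G` and `b`.
  obtain ⟨N, hN⟩ := eventually_atTop.1
    ((h1.eventually (gt_mem_nhds ENNReal.zero_lt_top)).and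
      (h2.eventually (gt_mem_nhds ENNReal.zero_lt_top)))
  have hG : ∀ m, MemLp (gradient (φ (m + N))) (ENNReal.ofReal p) (weighted σ) := fun m => by
    have : MemLp (fun x => gradient (φ (m + N)) x - G x) (ENNReal.ofReal p) (weighted σ) :=
      ⟨(hφ _).continuous_gradient.aestronglyMeasurable.sub (Lp.aestronglyMeasurable G),
        (hN (m + N) (by simp)).1⟩
    simpa [Pi.add_def] using this.add (Lp.memLp G)
  have hb : ∀ m, MemLp (φ (m + N)) 2 (weighted β) := fun m => by
    have : MemLp (fun x => φ (m + N) x - b x) 2 (weighted β) :=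
      ⟨(hφ _).1.continuous.aestronglyMeasurable.sub (Lp.aestronglyMeasurable b),
        (hN (m + N) (by simp)).2⟩
    simpa [Pi.add_def] using this.add (Lp.memLp b)
  have t1 : Tendsto (fun m => (hG m).toLp) atTop (𝓝 G) := by
    have := (Lp.tendsto_Lp_iff_tendsto_eLpNorm'' _ hG G (Lp.memLp G)).2
      (h1.comp (tendsto_add_atTop_nat N))
    rwa [Lp.toLp_coeFn] at this
  have t2 : Tendsto (fun m => (hb m).toLp) atTop (𝓝 b) := by
    have := (Lp.tendsto_Lp_iff_tendsto_eLpNorm'' _ hb b (Lp.memLp b)).2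
      (h2.comp (tendsto_add_atTop_nat N))
    rwa [Lp.toLp_coeFn] at this
  have t3 : Tendsto (fun m => (WithLp.toLp 1 ((hG m).toLp, (hb m).toLp) : Ambient n p σ β))
      atTop (𝓝 (WithLp.toLp 1 (G, b))) :=
    ((WithLp.prod_continuous_toLp 1 _ _).tendsto (G, b)).comp (t1.prodMk_nhds t2)
  have hmem : (WithLp.toLp 1 (G, b) : Ambient n p σ β) ∈ W n p σ β :=
    mem_closure_of_tendsto t3 (.of_forall fun m =>
      ⟨φ (m + N), hφ _, (hG m).coeFn_toLp, (hb m).coeFn_toLp⟩)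
  refine ⟨⟨_, hmem⟩, rfl, rfl, φ, hφ, ?_, h3⟩
  simpa using h1.add h2

theorem W.Represents.sub {w z : W n p σ β} {u v : L2 n} (hw : W.Represents w u)
    (hz : W.Represents z v) : W.Represents (w - z) (u - v) := by
  obtain ⟨φ, hφ, a1, a2, a3, -⟩ := hw.exists_ae_tendsto
  obtain ⟨ψ, hψ, b1, b2, b3, -⟩ := hz.exists_ae_tendsto
  have e1 : ∀ m, (fun x => gradient (fun x => φ m x - ψ m x) x - (w - z).1.fst x)
      =ᵐ[weighted σ] (fun x => gradient (φ m) x - w.1.fst x) -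
        fun x => gradient (ψ m) x - z.1.fst x := fun m => by
    filter_upwards [Lp.coeFn_sub w.1.fst z.1.fst] with x hx
    have hx' : (w - z).1.fst x = w.1.fst x - z.1.fst x := hx
    rw [(hφ m).gradient_sub (hψ m), hx', Pi.sub_apply]
    abel
  have e2 : ∀ m, (fun x => (φ m x - ψ m x) - (w - z).1.snd x)
      =ᵐ[weighted β] (fun x => φ m x - w.1.snd x) - fun x => ψ m x - z.1.snd x := fun m => by
    filter_upwards [Lp.coeFn_sub w.1.snd z.1.snd] with x hx
    have hx' : (w - z).1.snd x = w.1.snd x - z.1.snd x := hx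
    rw [hx', Pi.sub_apply]
    abel
  have e3 : ∀ m, (fun x => (φ m x - ψ m x) - (u - v : L2 n) x)
      =ᵐ[volume] (fun x => φ m x - u x) - fun x => ψ m x - v x := fun m => by
    filter_upwards [Lp.coeFn_sub u v] with x hx
    rw [hx, Pi.sub_apply, Pi.sub_apply]
    abel
  have hc : ∀ m, Continuous (φ m) := fun m => (hφ m).1.continuous
  have hc' : ∀ m, Continuous (ψ m) := fun m => (hψ m).1.continuous
  refine ⟨fun m x => φ m x - ψ m x, fun m => (hφ m).sub (hψ m), ?_, ?_⟩
  · have := (a1.add b1).add (a2.add b2)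
    simp only [add_zero] at this
    refine tendsto_of_tendsto_of_tendsto_of_le_of_le tendsto_const_nhds this
      (fun _ => zero_le) (fun m => add_le_add ?_ ?_)
    · rw [eLpNorm_congr_ae (e1 m)]
      exact eLpNorm_sub_le
        ((hφ m).continuous_gradient.aestronglyMeasurable.sub (Lp.aestronglyMeasurable _))
        ((hψ m).continuous_gradient.aestronglyMeasurable.sub (Lp.aestronglyMeasurable _))
        (factOneLe p).out
    · rw [eLpNorm_congr_ae (e2 m)]
      exact eLpNorm_sub_le ((hc m).aestronglyMeasurable.sub (Lp.aestronglyMeasurable _))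
        ((hc' m).aestronglyMeasurable.sub (Lp.aestronglyMeasurable _)) (by norm_num)
  · have := a3.add b3
    simp only [add_zero] at this
    refine tendsto_of_tendsto_of_tendsto_of_le_of_le tendsto_const_nhds this
      (fun _ => zero_le) (fun m => ?_)
    simp only
    rw [eLpNorm_congr_ae (e3 m)]
    exact eLpNorm_sub_le ((hc m).aestronglyMeasurable.sub (Lp.aestronglyMeasurable _))
      ((hc' m).aestronglyMeasurable.sub (Lp.aestronglyMeasurable _)) (by norm_num)

/-- The chain rule in `W` for a smooth function with derivative bounded by one. -/
theorem W.Represents.exists_comp {w : W n p σ β} {u : L2 n} (hw : W.Represents w u) {h : ℝ → ℝ}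
    (hh : ContDiff ℝ ∞ h) (h0 : h 0 = 0) (h1 : ∀ s, |deriv h s| ≤ 1) :
    ∃ (z : W n p σ β) (v : L2 n), W.Represents z v ∧ v =ᵐ[volume] (fun x => h (u x)) ∧
      z.1.fst =ᵐ[weighted σ] (fun x => deriv h (u x) • w.1.fst x) ∧
      z.1.snd =ᵐ[weighted β] (fun x => h (u x)) := by
  obtain ⟨φ, hφ, a1, a2, a3, a4⟩ := hw.exists_ae_tendsto
  have hlip : ∀ a b, |h a - h b| ≤ |a - b| := fun a b => by
    have := Convex.norm_image_sub_le_of_norm_deriv_le (f := h) (C := 1) (s := univ)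
      (fun x _ => hh.differentiable (by simp) x) (fun x _ => h1 x) convex_univ
      (mem_univ b) (mem_univ a)
    simpa using this
  have habs : ∀ a, |h a| ≤ |a| := fun a => by simpa [h0] using hlip a 0
  have hdc : Continuous (deriv h) := hh.continuous_deriv (by simp)
  have husm : StronglyMeasurable u := Lp.stronglyMeasurable u
  have hhu : StronglyMeasurable fun x => h (u x) := hh.continuous.comp_stronglyMeasurable husm
  have hdu : StronglyMeasurable fun x => deriv h (u x) := hdc.comp_stronglyMeasurable husm
  have hGm : MemLp (fun x => deriv h (u x) • w.1.fst x) (ENNReal.ofReal p) (weighted σ) :=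
    (Lp.memLp w.1.fst).of_le (hdu.aestronglyMeasurable.smul (Lp.aestronglyMeasurable _))
      (.of_forall fun x => by
        rw [norm_smul]
        exact mul_le_of_le_one_left (norm_nonneg _) (h1 _))
  have hum : MemLp (fun x => h (u x)) 2 volume :=
    (Lp.memLp u).of_le hhu.aestronglyMeasurable (.of_forall fun x => habs _)
  have hbm : MemLp (fun x => h (u x)) 2 (weighted β) :=
    (Lp.memLp w.1.snd).of_le hhu.aestronglyMeasurable (by
      filter_upwards [hw.snd_ae_eq] with x hx
      rw [hx]
      exact habs _)
  obtain ⟨z, hz1, hz2, hz3⟩ : ∃ z : W n p σ β, z.1.fst = hGm.toLp ∧ z.1.snd = hbm.toLp ∧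
      W.Represents z hum.toLp := by
    refine W.exists_represents_of_tendsto (fun m => (hφ m).comp hh h0) hGm.toLp hbm.toLp
      hum.toLp ?_ ?_ ?_
    -- With `G` the gradient of `w`, write `h'(φ_m) ∇φ_m - h'(u) G = h'(φ_m) (∇φ_m - G) + (h'(φ_m) -
    -- h'(u)) G`. The first term is controlled by `|h'| ≤ 1`, the second by dominated convergence
    -- with majorant `2‖G‖`.
    · have hD : Tendsto (fun m => eLpNorm (fun x => (deriv h (φ m x) - deriv h (u x)) • w.1.fst x)
          (ENNReal.ofReal p) (weighted σ)) atTop (𝓝 0) := by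
        refine tendsto_eLpNorm_zero_of_dominated (g := fun x => 2 * ‖w.1.fst x‖)
          (zero_lt_one.trans_le (factOneLe p).out).ne' ENNReal.ofReal_ne_top (fun m => ?_)
          ((Lp.memLp w.1.fst).norm.const_mul 2) (fun m => ?_) ?_
        · exact ((hdc.comp (hφ m).1.continuous).aestronglyMeasurable.sub
            hdu.aestronglyMeasurable).smul (Lp.aestronglyMeasurable _)
        · refine .of_forall fun x => ?_
          rw [norm_smul]
          refine mul_le_mul_of_nonneg_right ((norm_sub_le _ _).trans ?_) (norm_nonneg _)
          have := h1 (φ m x)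
          have := h1 (u x)
          simp only [Real.norm_eq_abs]
          linarith
        · filter_upwards [(weighted_absolutelyContinuous σ).ae_le a4] with x hx
          have := ((((hdc.tendsto (u x)).comp hx).sub_const (deriv h (u x))).smul_const (w.1.fst x))
          simpa using this
      have := a1.add hD
      rw [add_zero] at this
      refine tendsto_of_tendsto_of_tendsto_of_le_of_le tendsto_const_nhds this
        (fun _ => zero_le) (fun m => ?_)
      have e : (fun x => gradient (fun x => h (φ m x)) x - hGm.toLp _ x) =ᵐ[weighted σ]
          (fun x => deriv h (φ m x) • (gradient (φ m) x - w.1.fst x)) +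
            fun x => (deriv h (φ m x) - deriv h (u x)) • w.1.fst x := by
        filter_upwards [hGm.coeFn_toLp] with x hx
        rw [hx, (hφ m).gradient_comp hh, Pi.add_apply, smul_sub, sub_smul]
        abel
      have hms : AEStronglyMeasurable (fun x => deriv h (φ m x) • (gradient (φ m) x - w.1.fst x))
          (weighted σ) := (hdc.comp (hφ m).1.continuous).aestronglyMeasurable.smul
            ((hφ m).continuous_gradient.aestronglyMeasurable.sub (Lp.aestronglyMeasurable _))
      simp only
      rw [eLpNorm_congr_ae e]
      refine (eLpNorm_add_le hms (((hdc.comp (hφ m).1.continuous).aestronglyMeasurable.sub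
        hdu.aestronglyMeasurable).smul (Lp.aestronglyMeasurable _)) (factOneLe p).out).trans
        (add_le_add_left ?_ _)
      refine eLpNorm_mono_ae (.of_forall fun x => ?_)
      rw [norm_smul]
      exact mul_le_of_le_one_left (norm_nonneg _) (h1 _)
    · refine tendsto_of_tendsto_of_tendsto_of_le_of_le tendsto_const_nhds a2
        (fun _ => zero_le) (fun m => eLpNorm_mono_ae ?_)
      filter_upwards [hbm.coeFn_toLp, hw.snd_ae_eq] with x hx hx'
      rw [hx, hx']
      exact hlip _ _
    · refine tendsto_of_tendsto_of_tendsto_of_le_of_le tendsto_const_nhds a3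
        (fun _ => zero_le) (fun m => eLpNorm_mono_ae ?_)
      filter_upwards [hum.coeFn_toLp] with x hx
      rw [hx]
      exact hlip _ _
  refine ⟨z, _, hz3, hum.coeFn_toLp, ?_, ?_⟩
  · rw [hz1]; exact hGm.coeFn_toLp
  · rw [hz2]; exact hbm.coeFn_toLp

end

/-! ### Continuity and monotonicity of the operator `A` -/

theorem integral_weighted {n : ℕ} {ρ : Space n → ℝ} (hρ : AEMeasurable ρ volume)
    (h0 : ∀ᵐ x, 0 ≤ ρ x) (F : Space n → ℝ) : ∫ x, F x ∂(weighted ρ) = ∫ x, ρ x * F x := by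
  rw [weighted, integral_withDensity_eq_integral_toReal_smul₀ hρ.ennreal_ofReal
    (.of_forall fun x => ENNReal.ofReal_lt_top)]
  refine integral_congr_ae ?_
  filter_upwards [h0] with x hx
  rw [ENNReal.toReal_ofReal hx, smul_eq_mul]

theorem inner_eq_integral_mul {α : Type*} {m : MeasurableSpace α} {μ : Measure α} (u v : Lp ℝ 2 μ) :
    inner ℝ u v = ∫ x, u x * v x ∂μ := by
  rw [L2.inner_def]
  refine integral_congr_ae (.of_forall fun x => ?_)
  simp [mul_comm]

theorem integrable_mul_of_Lp {α : Type*} {m : MeasurableSpace α} {μ : Measure α} (u v : Lp ℝ 2 μ) :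
    Integrable (fun x => u x * v x) μ :=
  (Lp.memLp u).integrable_mul (Lp.memLp v)

/-- The inner product splits into a nonnegative multiple of `‖a - b‖²` and a term with the factor
`(‖a‖ ^ r - ‖b‖ ^ r) (‖a‖ - ‖b‖)`, which is nonnegative because `t ↦ t ^ r` is nondecreasing. -/
theorem inner_rpow_smul_sub_nonneg {E : Type*} [NormedAddCommGroup E] [InnerProductSpace ℝ E]
    {r : ℝ} (hr : 0 ≤ r) (a b : E) : 0 ≤ inner ℝ (‖a‖ ^ r • a - ‖b‖ ^ r • b) (a - b) := by
  have h1 : inner ℝ (‖a‖ ^ r • a - ‖b‖ ^ r • b) (a - b) =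
      (‖a‖ ^ r + ‖b‖ ^ r) / 2 * ‖a - b‖ ^ 2 +
        (‖a‖ ^ r - ‖b‖ ^ r) * (‖a‖ - ‖b‖) * ((‖a‖ + ‖b‖) / 2) := by
    rw [norm_sub_sq_real]
    simp only [inner_sub_left, inner_sub_right, real_inner_smul_left, real_inner_self_eq_norm_sq,
      real_inner_comm a b]
    ring
  rw [h1]
  have h2 : 0 ≤ (‖a‖ ^ r - ‖b‖ ^ r) * (‖a‖ - ‖b‖) := by
    rcases le_total ‖a‖ ‖b‖ with h | h
    · exact mul_nonneg_of_nonpos_of_nonpos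
        (sub_nonpos.2 (Real.rpow_le_rpow (norm_nonneg _) h hr)) (sub_nonpos.2 h)
    · exact mul_nonneg
        (sub_nonneg.2 (Real.rpow_le_rpow (norm_nonneg _) h hr)) (sub_nonneg.2 h)
  positivity

theorem holderConjugate_ofReal {p : ℝ} (hp : 2 ≤ p) :
    ENNReal.HolderConjugate (ENNReal.ofReal p / ENNReal.ofReal (p - 1)) (ENNReal.ofReal p) := by
  rw [← ENNReal.ofReal_div_of_pos (by linarith)]
  have : (p / (p - 1)).HolderConjugate p := (Real.HolderConjugate.conjExponent (by linarith)).symm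
  exact this.ennrealOfReal

section PairA

variable {n : ℕ} {p : ℝ} [hp : Fact (2 ≤ p)] {σ β : Space n → ℝ}

/-- The norm of the field is `‖∇w‖ ^ (p - 1)`, and `∇w` is in `L^p`. -/
theorem memLp_flux (w : W n p σ β) :
    MemLp (fun x => ‖W.grad w x‖ ^ (p - 2) • W.grad w x)
      (ENNReal.ofReal p / ENNReal.ofReal (p - 1)) (weighted σ) := by
  have h2 : 2 ≤ p := hp.out
  have hG := Lp.stronglyMeasurable (W.grad w)
  have := (Lp.memLp (W.grad w)).norm_rpow_div (ENNReal.ofReal (p - 1))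
  rw [ENNReal.toReal_ofReal (by linarith)] at this
  refine this.of_le ?_ (.of_forall fun x => ?_)
  · exact ((hG.norm.measurable.pow_const (p - 2)).stronglyMeasurable.smul hG).aestronglyMeasurable
  · rw [norm_smul, Real.norm_of_nonneg (by positivity), Real.norm_of_nonneg (by positivity)]
    rcases (norm_nonneg (W.grad w x)).eq_or_lt with h | h
    · rw [← h, mul_zero]
      positivity
    · rw [← Real.rpow_add_one h.ne']
      exact le_of_eq (by ring_nf)

/-- The field `|∇w|^{p-2} ∇w`. -/
noncomputable def flux (w : W n p σ β) :
    Lp (Space n) (ENNReal.ofReal p / ENNReal.ofReal (p - 1)) (weighted σ) :=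
  (memLp_flux w).toLp

theorem flux_ae_eq (w : W n p σ β) :
    flux w =ᵐ[weighted σ] fun x => ‖W.grad w x‖ ^ (p - 2) • W.grad w x :=
  (memLp_flux w).coeFn_toLp

theorem integrable_inner_flux (w z : W n p σ β) :
    Integrable (fun x => inner ℝ (flux w x) (W.grad z x)) (weighted σ) := by
  have := holderConjugate_ofReal hp.out
  exact memLp_one_iff_integrable.1
    ((innerSL ℝ).memLp_of_bilin 1 (Lp.memLp (flux w)) (Lp.memLp (W.grad z)))

theorem pairA_eq (hσ : AEMeasurable σ volume) (hσ0 : ∀ᵐ x, 0 ≤ σ x) (hβ : AEMeasurable β volume)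
    (hβ0 : ∀ᵐ x, 0 ≤ β x) (w z : W n p σ β) :
    pairA w z = (∫ x, inner ℝ (flux w x) (W.grad z x) ∂(weighted σ))
      + inner ℝ w.1.snd z.1.snd := by
  rw [pairA, ← integral_weighted hσ hσ0, ← integral_weighted hβ hβ0, inner_eq_integral_mul]
  congr 1
  refine integral_congr_ae ?_
  filter_upwards [flux_ae_eq w] with x hx
  rw [hx, real_inner_smul_left]

/-- By Hölder, the flux in `L^{p/(p-1)}_σ` acts continuously on gradients in `L^p_σ`; the damping
term is an inner product in `L²_β`. -/
theorem continuous_pairA (hσ : AEMeasurable σ volume) (hσ0 : ∀ᵐ x, 0 ≤ σ x)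
    (hβ : AEMeasurable β volume) (hβ0 : ∀ᵐ x, 0 ≤ β x) (w : W n p σ β) :
    Continuous fun z : W n p σ β => pairA w z := by
  have := holderConjugate_ofReal hp.out
  have hq : Fact (1 ≤ ENNReal.ofReal p / ENNReal.ofReal (p - 1)) :=
    ⟨ENNReal.HolderConjugate.one_le _ (ENNReal.ofReal p)⟩
  have e : (fun z : W n p σ β => pairA w z) = fun z =>
      (innerSL ℝ).lpPairing (weighted σ) (ENNReal.ofReal p / ENNReal.ofReal (p - 1))
        (ENNReal.ofReal p) (flux w) z.1.fst + inner ℝ w.1.snd z.1.snd := by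
    funext z
    rw [pairA_eq hσ hσ0 hβ hβ0, ContinuousLinearMap.lpPairing_eq_integral]
    rfl
  rw [e]
  have c : Continuous fun z : W n p σ β => WithLp.ofLp z.1 :=
    (WithLp.prod_continuous_ofLp 1 _ _).comp continuous_subtype_val
  have c1 : Continuous fun z : W n p σ β => z.1.fst := continuous_fst.comp c
  have c2 : Continuous fun z : W n p σ β => z.1.snd := continuous_snd.comp c
  exact ((ContinuousLinearMap.continuous _).comp c1).add (continuous_const.inner c2)

/-- Monotonicity survives truncation: with `k = h'(w₁ - w₂)` the diffusion integrand is `k ≥ 0`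
times that of the untruncated test function. -/
theorem pairA_sub_nonneg (hσ : AEMeasurable σ volume) (hσ0 : ∀ᵐ x, 0 ≤ σ x)
    (hβ : AEMeasurable β volume) (hβ0 : ∀ᵐ x, 0 ≤ β x) {w₁ w₂ z : W n p σ β} {k : Space n → ℝ}
    (hk : ∀ x, 0 ≤ k x) (h1 : z.1.fst =ᵐ[weighted σ] fun x => k x • (w₁ - w₂).1.fst x)
    (h2 : ∀ᵐ x ∂(weighted β), 0 ≤ (w₁ - w₂).1.snd x * z.1.snd x) :
    0 ≤ pairA w₁ z - pairA w₂ z := by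
  rw [pairA_eq hσ hσ0 hβ hβ0, pairA_eq hσ hσ0 hβ hβ0]
  have e : ∀ a b c d : ℝ, a + b - (c + d) = (a - c) + (b - d) := fun _ _ _ _ => by ring
  rw [e, ← integral_sub (integrable_inner_flux w₁ z) (integrable_inner_flux w₂ z),
    ← inner_sub_left]
  refine add_nonneg (integral_nonneg_of_ae ?_) ?_
  · filter_upwards [h1, flux_ae_eq w₁, flux_ae_eq w₂, Lp.coeFn_sub w₁.1.fst w₂.1.fst]
      with x hx a1 a2 a3
    have hx' : W.grad z x = k x • (W.grad w₁ x - W.grad w₂ x) := by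
      exact hx.trans (congrArg (k x • ·) a3)
    simp only [Pi.zero_apply]
    rw [← inner_sub_left, a1, a2, hx', real_inner_smul_right]
    exact mul_nonneg (hk x) (inner_rpow_smul_sub_nonneg (by linarith [hp.out]) _ _)
  · rw [inner_eq_integral_mul]
    exact integral_nonneg_of_ae h2

end PairA

/-! ### The source term -/

section Source

variable {n : ℕ} {f : ℝ → ℝ}

/-- The sign condition and continuity force `f 0 = 0`; the rest is the mean value inequality. -/
theorem exists_abs_le_of_contDiff (hf : ContDiff ℝ 1 f) (hs : ∀ s, 0 ≤ f s * s) :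
    ∃ M : ℝ, 0 ≤ M ∧ ∀ s ∈ Icc (-1 : ℝ) 1, |f s| ≤ M * |s| := by
  have h0 : f 0 = 0 := by
    have h1 : 0 ≤ f 0 := by
      refine ge_of_tendsto (hf.continuous.tendsto 0 |>.mono_left nhdsWithin_le_nhds :
        Tendsto f (𝓝[>] 0) (𝓝 (f 0))) ?_
      filter_upwards [self_mem_nhdsWithin] with s h
      exact nonneg_of_mul_nonneg_left (hs s) h
    have h2 : f 0 ≤ 0 := by
      refine le_of_tendsto (hf.continuous.tendsto 0 |>.mono_left nhdsWithin_le_nhds :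
        Tendsto f (𝓝[<] 0) (𝓝 (f 0))) ?_
      filter_upwards [self_mem_nhdsWithin] with s h
      exact nonpos_of_mul_nonneg_left (hs s) h
    exact le_antisymm h2 h1
  obtain ⟨M, hM⟩ := (isCompact_Icc (a := (-1 : ℝ)) (b := 1)).exists_bound_of_continuousOn
    (hf.continuous_deriv le_rfl).continuousOn
  refine ⟨M, (norm_nonneg _).trans (hM 0 (by simp)), fun s h => ?_⟩
  have := Convex.norm_image_sub_le_of_norm_deriv_le (f := f) (C := M) (s := Icc (-1) 1)
    (fun x _ => hf.differentiable (by simp) x) hM (convex_Icc _ _)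
    (by simp : (0 : ℝ) ∈ Icc (-1 : ℝ) 1) h
  simpa [h0] using this

theorem integrable_source_mul (hf : Continuous f) (hs : ∀ s, 0 ≤ f s * s) {u : L2 n}
    (hu : ∫⁻ x, ENNReal.ofReal (f (u x) * u x) < ⊤) :
    Integrable (fun x => f (u x) * u x) volume := by
  have hum := Lp.stronglyMeasurable u
  refine ⟨((hf.comp_stronglyMeasurable hum).mul hum).aestronglyMeasurable, ?_⟩
  rwa [hasFiniteIntegral_iff_ofReal (.of_forall fun x => hs _)]

/-- The nonlinearity splits into a part in `L²` and a part in `L¹`. -/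
theorem exists_source_split (hf : ContDiff ℝ 1 f) (hs : ∀ s, 0 ≤ f s * s) {u : L2 n}
    (hu : ∫⁻ x, ENNReal.ofReal (f (u x) * u x) < ⊤) :
    ∃ (a : L2 n) (b : Space n → ℝ), Integrable b volume ∧
      ∀ᵐ x, f (u x) = a x + b x := by
  obtain ⟨M, hM0, hM⟩ := exists_abs_le_of_contDiff hf hs
  have hum := Lp.stronglyMeasurable u
  have hfu := hf.continuous.comp_stronglyMeasurable hum
  -- Where `|u| ≤ 1`, `|f(u)| ≤ M |u|` is in `L²`; elsewhere `|f(u)| ≤ f(u) u` is in `L¹`.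
  have hset : MeasurableSet (u ⁻¹' Icc (-1) 1) := hum.measurable measurableSet_Icc
  have ha : MemLp ((u ⁻¹' Icc (-1) 1).indicator fun x => f (u x)) 2 volume := by
    refine ((Lp.memLp u).const_mul M).of_le (hfu.indicator hset).aestronglyMeasurable
      (.of_forall fun x => ?_)
    by_cases hx : x ∈ u ⁻¹' Icc (-1) 1
    · rw [indicator_of_mem hx, norm_mul, Real.norm_of_nonneg hM0]
      exact hM _ hx
    · rw [indicator_of_notMem hx, norm_zero]
      positivity
  have hb : Integrable ((u ⁻¹' Icc (-1) 1)ᶜ.indicator fun x => f (u x)) volume := by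
    refine (integrable_source_mul hf.continuous hs hu).mono
      (hfu.indicator hset.compl).aestronglyMeasurable (.of_forall fun x => ?_)
    by_cases hx : x ∈ (u ⁻¹' Icc (-1) 1)ᶜ
    · rw [indicator_of_mem hx, norm_mul]
      refine le_mul_of_one_le_right (norm_nonneg _) ?_
      by_contra! h
      exact hx (abs_le.1 h.le)
    · rw [indicator_of_notMem hx, norm_zero]
      positivity
  refine ⟨ha.toLp, _, hb, ?_⟩
  filter_upwards [ha.coeFn_toLp] with x hx
  rw [hx, ← Pi.add_apply, indicator_self_add_compl]

theorem integrable_source_mul_of_bounded (hf : ContDiff ℝ 1 f) (hs : ∀ s, 0 ≤ f s * s) {u : L2 n}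
    (hu : ∫⁻ x, ENNReal.ofReal (f (u x) * u x) < ⊤) {v : L2 n} {K : ℝ} (hv : ∀ᵐ x, |v x| ≤ K) :
    Integrable (fun x => f (u x) * v x) volume := by
  obtain ⟨a, b, hb, hab⟩ := exists_source_split hf hs hu
  have h1 := (integrable_mul_of_Lp a v).add
    (hb.mul_bdd (c := K) (Lp.aestronglyMeasurable v) hv)
  refine h1.congr ?_
  filter_upwards [hab] with x hx
  rw [hx, add_mul, Pi.add_apply]

/-- The `L²` part of `f(u)` uses convergence in `L²`; the `L¹` part `b` uses dominated convergence
with majorant `K |b|`, hence the common bound `K`. -/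
theorem tendsto_integral_source_mul (hf : ContDiff ℝ 1 f) (hs : ∀ s, 0 ≤ f s * s) {u : L2 n}
    (hu : ∫⁻ x, ENNReal.ofReal (f (u x) * u x) < ⊤) {v : L2 n} {vs : ℕ → L2 n} {K : ℝ}
    (hvs : ∀ m, ∀ᵐ x, |vs m x| ≤ K) (hv : ∀ᵐ x, |v x| ≤ K) (hlim : Tendsto vs atTop (𝓝 v))
    (hae : ∀ᵐ x, Tendsto (fun m => vs m x) atTop (𝓝 (v x))) :
    Tendsto (fun m => ∫ x, f (u x) * vs m x) atTop (𝓝 (∫ x, f (u x) * v x)) := by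
  obtain ⟨a, b, hb, hab⟩ := exists_source_split hf hs hu
  have e : ∀ z : L2 n, (∀ᵐ x, |z x| ≤ K) →
      ∫ x, f (u x) * z x = inner ℝ a z + ∫ x, b x * z x := fun z hz => by
    rw [inner_eq_integral_mul, ← integral_add (integrable_mul_of_Lp a z)
      (hb.mul_bdd (c := K) (Lp.aestronglyMeasurable z) hz)]
    refine integral_congr_ae ?_
    filter_upwards [hab] with x hx
    rw [hx, add_mul]
  rw [e v hv, funext fun m => e (vs m) (hvs m)]
  refine (tendsto_const_nhds.inner hlim).add ?_
  refine tendsto_integral_of_dominated_convergence (fun x => ‖b x‖ * K)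
    (fun m => hb.1.mul (Lp.aestronglyMeasurable _)) (hb.norm.mul_const K) (fun m => ?_) ?_
  · filter_upwards [hvs m] with x hx
    rw [norm_mul]
    exact mul_le_mul_of_nonneg_left hx (norm_nonneg _)
  · filter_upwards [hae] with x hx
    exact hx.const_mul _

theorem Lp_exists_subseq_ae_tendsto {α : Type*} {m : MeasurableSpace α} {μ : Measure α}
    {vs : ℕ → Lp ℝ 2 μ} {v : Lp ℝ 2 μ} (h : Tendsto vs atTop (𝓝 v)) :
    ∃ ns : ℕ → ℕ, StrictMono ns ∧ ∀ᵐ x ∂μ, Tendsto (fun m => vs (ns m) x) atTop (𝓝 (v x)) :=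
  (tendstoInMeasure_of_tendsto_Lp h).exists_seq_tendsto_ae

/-- Fatou's lemma along an a.e. convergent subsequence. This supplies the measurability in time of
`∫ f(u) u dx`, so that a finite time integral gives finiteness at a.e. time. -/
theorem lowerSemicontinuous_lintegral_comp {α : Type*} {m : MeasurableSpace α} {μ : Measure α}
    {F : ℝ → ℝ≥0∞} (hF : Continuous F) :
    LowerSemicontinuous fun u : Lp ℝ 2 μ => ∫⁻ x, F (u x) ∂μ := by
  rw [lowerSemicontinuous_iff_isClosed_preimage]
  intro y
  refine IsSeqClosed.isClosed fun us u hus hlim => ?_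
  obtain ⟨ns, hns, hae⟩ := Lp_exists_subseq_ae_tendsto hlim
  have h1 : ∫⁻ x, F (u x) ∂μ = ∫⁻ x, liminf (fun m => F (us (ns m) x)) atTop ∂μ := by
    refine lintegral_congr_ae ?_
    filter_upwards [hae] with x hx
    exact ((hF.tendsto _).comp hx).liminf_eq.symm
  simp only [mem_preimage, mem_Iic] at hus ⊢
  rw [h1]
  refine (lintegral_liminf_le' fun m => ?_).trans ?_
  · exact (hF.measurable.comp (Lp.stronglyMeasurable (us (ns m))).measurable).aemeasurable
  · exact liminf_le_of_le (by isBoundedDefault) fun b hb => by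
      obtain ⟨m, hm⟩ := hb.exists
      exact hm.trans (hus _)

theorem ae_lintegral_source_lt_top (hf : Continuous f) {T : ℝ} {u : ℝ → L2 n}
    (hu : ContinuousOn u (Icc 0 T))
    (h : (∫⁻ t in Ioo 0 T, ∫⁻ x, ENNReal.ofReal (f (u t x) * u t x)) < ⊤) :
    ∀ᵐ t ∂(volume.restrict (Ioo 0 T)), ∫⁻ x, ENNReal.ofReal (f (u t x) * u t x) < ⊤ := by
  refine ae_lt_top' ?_ h.ne
  have hc : Continuous fun s : ℝ => ENNReal.ofReal (f s * s) :=
    ENNReal.continuous_ofReal.comp (hf.mul continuous_id)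
  borelize (L2 n)
  exact (lowerSemicontinuous_lintegral_comp hc).measurable.comp_aemeasurable
    ((hu.mono Ioo_subset_Icc_self).aemeasurable measurableSet_Ioo)

end Source

/-! ### The equation at a fixed time, truncation and conclusion -/

section

variable {n : ℕ} {p : ℝ} [hp : Fact (2 ≤ p)] {σ β : Space n → ℝ} {f : ℝ → ℝ} {c : ℝ}

theorem DampingCondition.aemeasurable (hβ : DampingCondition n β) : AEMeasurable β volume :=
  hβ.essBounded.1.aemeasurable

omit hp in
theorem DiffusionCondition.aemeasurable (hσ : DiffusionCondition n p σ) : AEMeasurable σ volume :=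
  hσ.locallyIntegrable.aestronglyMeasurable.aemeasurable

/-- The elements of `W` represented by functions bounded by `K`. -/
def boundedPairs (p : ℝ) [Fact (2 ≤ p)] (σ β : Space n → ℝ) (K : ℝ) : Set (W n p σ β × L2 n) :=
  {q | W.Represents q.1 q.2 ∧ ∀ᵐ x, |q.2 x| ≤ K}

/-- Both exponents are finite and the weighted measures are s-finite, so `W × L²` is separable, and
so is each of its subsets. The dense set is taken inside the bounded pairs to keep the bound `K`. -/
theorem exists_countable_dense_boundedPairs (p : ℝ) [Fact (2 ≤ p)] (σ β : Space n → ℝ) (K : ℝ) :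
    ∃ D ⊆ boundedPairs p σ β K, D.Countable ∧ boundedPairs p σ β K ⊆ closure D := by
  have i1 : Fact (ENNReal.ofReal p ≠ ⊤) := ⟨ENNReal.ofReal_ne_top⟩
  have i2 : Fact ((2 : ℝ≥0∞) ≠ ⊤) := ⟨by norm_num⟩
  have i3 : SFinite (weighted σ) := by unfold weighted; infer_instance
  have i4 : SFinite (weighted β) := by unfold weighted; infer_instance
  have i5 : SecondCountableTopology (Ambient n p σ β) := inferInstance
  exact (TopologicalSpace.IsSeparable.of_separableSpace _).exists_countable_dense_subset

/-- The equation at a fixed time, tested with the pair `(z, v)`. -/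
def TestedEquation (f : ℝ → ℝ) (g u u' : L2 n) (U : W n p σ β) (q : W n p σ β × L2 n) : Prop :=
  (∫ x, u' x * q.2 x) + pairA U q.1 + (∫ x, f (u x) * q.2 x) = ∫ x, g x * q.2 x

theorem TestedEquation.of_mem_closure (hσ : DiffusionCondition n p σ) (hβ : DampingCondition n β)
    (hf : SourceCondition f c) {g u u' : L2 n} {U : W n p σ β}
    (hu : ∫⁻ x, ENNReal.ofReal (f (u x) * u x) < ⊤) {K : ℝ} {D : Set (W n p σ β × L2 n)}
    (hD : D ⊆ boundedPairs p σ β K) (heq : ∀ q ∈ D, TestedEquation f g u u' U q)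
    {q : W n p σ β × L2 n} (hq : q ∈ boundedPairs p σ β K) (hqD : q ∈ closure D) :
    TestedEquation f g u u' U q := by
  obtain ⟨qs, hqs, hlim⟩ := mem_closure_iff_seq_limit.1 hqD
  have hlim2 : Tendsto (fun m => (qs m).2) atTop (𝓝 q.2) := (continuous_snd.tendsto q).comp hlim
  obtain ⟨ns, hns, hae⟩ := Lp_exists_subseq_ae_tendsto hlim2
  have hlim' := hlim.comp hns.tendsto_atTop
  have hlim1' : Tendsto (fun m => (qs (ns m)).1) atTop (𝓝 q.1) :=
    (continuous_fst.tendsto q).comp hlim'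
  have hlim2' : Tendsto (fun m => (qs (ns m)).2) atTop (𝓝 q.2) := hlim2.comp hns.tendsto_atTop
  have t1 : ∀ a : L2 n, Tendsto (fun m => ∫ x, a x * (qs (ns m)).2 x) atTop
      (𝓝 (∫ x, a x * q.2 x)) := fun a => by
    simp_rw [← inner_eq_integral_mul]
    exact tendsto_const_nhds.inner hlim2'
  have t2 : Tendsto (fun m => pairA U (qs (ns m)).1) atTop (𝓝 (pairA U q.1)) :=
    ((continuous_pairA hσ.aemeasurable hσ.nonneg hβ.aemeasurable hβ.nonneg U).tendsto _).comp
      hlim1'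
  have t3 := tendsto_integral_source_mul hf.contDiff hf.sign hu
    (fun m => (hD (hqs (ns m))).2) hq.2 hlim2' hae
  exact tendsto_nhds_unique (((t1 u').add t2).add t3)
    ((t1 g).congr fun m => (heq _ (hqs (ns m))).symm)

/-- Countably many null sets are discarded, one for each element of a dense set and each integer
`K`; at the remaining times the equation extends by continuity. Test functions depending on `t`
thereby become admissible. -/
theorem ae_forall_testedEquation (hσ : DiffusionCondition n p σ) (hβ : DampingCondition n β)
    (hf : SourceCondition f c) {g : L2 n} {T : ℝ} {u u' : ℝ → L2 n} {U : ℝ → W n p σ β}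
    (hu : ∀ᵐ t ∂(volume.restrict (Ioo 0 T)), ∫⁻ x, ENNReal.ofReal (f (u t x) * u t x) < ⊤)
    (heq : ∀ (z : W n p σ β) (v : L2 n), W.Represents z v → MemLp v ⊤ volume →
      ∀ᵐ t ∂(volume.restrict (Ioo 0 T)), TestedEquation f g (u t) (u' t) (U t) (z, v)) :
    ∀ᵐ t ∂(volume.restrict (Ioo 0 T)), ∀ K : ℕ, ∀ q ∈ boundedPairs p σ β K,
      TestedEquation f g (u t) (u' t) (U t) q := by
  rw [ae_all_iff]
  intro K
  obtain ⟨D, hD, hDc, hDd⟩ := exists_countable_dense_boundedPairs p σ β K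
  have h1 : ∀ᵐ t ∂(volume.restrict (Ioo 0 T)), ∀ q ∈ D,
      TestedEquation f g (u t) (u' t) (U t) q := by
    rw [ae_ball_iff hDc]
    intro q hq
    exact heq q.1 q.2 (hD hq).1 (memLp_top_of_bound (Lp.aestronglyMeasurable _) K (hD hq).2)
  filter_upwards [hu, h1] with t ht1 ht2 q hq
  exact .of_mem_closure hσ hβ hf ht1 hD ht2 hq (hDd hq)

theorem deriv_mul_arctan_div {k : ℝ} (hk : 0 < k) (s : ℝ) :
    deriv (fun s => k * Real.arctan (s / k)) s = 1 / (1 + (s / k) ^ 2) := by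
  have h1 : HasDerivAt (fun s : ℝ => s / k) (1 / k) s := (hasDerivAt_id s).div_const k
  rw [(h1.arctan.const_mul k).deriv]
  field_simp

/-- Smooth bounded approximations of the identity function. -/
theorem exists_smooth_truncation : ∃ h : ℕ → ℝ → ℝ, (∀ m, ContDiff ℝ ∞ (h m)) ∧
    (∀ m, h m 0 = 0) ∧ (∀ m s, 0 ≤ deriv (h m) s) ∧ (∀ m s, deriv (h m) s ≤ 1) ∧
    (∀ m, ∃ K : ℕ, ∀ s, |h m s| ≤ K) ∧ ∀ s, Tendsto (fun m => h m s) atTop (𝓝 s) := by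
  have hk : ∀ m : ℕ, (0 : ℝ) < m + 1 := fun m => by positivity
  refine ⟨fun m s => (m + 1) * Real.arctan (s / (m + 1)), fun m => ?_, fun m => by simp,
    fun m s => ?_, fun m s => ?_, fun m => ?_, fun s => ?_⟩
  · exact contDiff_const.mul (Real.contDiff_arctan.comp (contDiff_id.div_const _))
  · rw [deriv_mul_arctan_div (hk m)]
    positivity
  · rw [deriv_mul_arctan_div (hk m)]
    exact div_le_one_of_le₀ (by nlinarith [sq_nonneg (s / (m + 1 : ℝ))]) (by positivity)
  · obtain ⟨K, hK⟩ := exists_nat_ge ((m + 1 : ℝ) * (Real.pi / 2))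
    refine ⟨K, fun s => le_trans ?_ hK⟩
    rw [abs_mul, abs_of_pos (hk m)]
    refine mul_le_mul_of_nonneg_left ?_ (hk m).le
    exact abs_le.2 ⟨(Real.neg_pi_div_two_lt_arctan _).le, (Real.arctan_lt_pi_div_two _).le⟩
  -- The `m`-th truncation at `s` is the difference quotient at `0` of `t ↦ arctan (s t)` with
  -- increment `1 / (m + 1)`.
  · have h1 : HasDerivAt (fun t : ℝ => Real.arctan (s * t)) s 0 := by
      have h2 : HasDerivAt (fun t : ℝ => s * t) (s * 1) 0 := (hasDerivAt_id (0 : ℝ)).const_mul s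
      simpa using h2.arctan
    have h3 : Tendsto (fun m : ℕ => 1 / ((m : ℝ) + 1)) atTop (𝓝[≠] 0) :=
      tendsto_nhdsWithin_iff.2 ⟨tendsto_one_div_add_atTop_nhds_zero_nat,
        .of_forall fun m => (one_div_pos.2 (hk m)).ne'⟩
    have := h1.tendsto_slope_zero.comp h3
    refine this.congr fun m => ?_
    simp [div_eq_mul_inv]

/-- Since `s ↦ f s + c s` is monotone, its increment has the sign of `a - b`, hence of `h (a - b)`;
the subtracted term `c (a - b) h (a - b)` is at most `c (a - b)²`. -/
theorem SourceCondition.sub_mul_ge (hf : SourceCondition f c) {h : ℝ → ℝ} {a b : ℝ}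
    (h1 : 0 ≤ (a - b) * h (a - b)) (h2 : |h (a - b)| ≤ |a - b|) :
    -(c * (a - b) ^ 2) ≤ (f a - f b) * h (a - b) := by
  have hmono : Monotone fun s => f s + c * s := by
    have hd : ∀ s, HasDerivAt (fun s => f s + c * s) (deriv f s + c * 1) s := fun s =>
      (hf.contDiff.differentiable (by simp) s).hasDerivAt.add ((hasDerivAt_id s).const_mul c)
    refine monotone_of_deriv_nonneg (fun s => (hd s).differentiableAt) fun s => ?_
    rw [(hd s).deriv]
    linarith [hf.deriv_gt s]
  have h3 : 0 ≤ (f a - f b + c * (a - b)) * h (a - b) := by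
    rcases lt_trichotomy a b with hab | hab | hab
    · have := hmono hab.le
      have h4 : h (a - b) ≤ 0 := by
        by_contra! h5
        nlinarith
      exact mul_nonneg_of_nonpos_of_nonpos (by simp only at this; linarith) h4
    · have : h (a - b) = 0 := by simpa [hab] using h2
      rw [this, mul_zero]
    · have := hmono hab.le
      have h4 : 0 ≤ h (a - b) := by
        by_contra! h5
        nlinarith
      exact mul_nonneg (by simp only at this; linarith) h4
  have h5 : (a - b) * h (a - b) ≤ (a - b) ^ 2 := by
    refine (le_abs_self _).trans ?_
    rw [abs_mul, ← sq_abs (a - b), sq]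
    exact mul_le_mul_of_nonneg_left h2 (abs_nonneg _)
  nlinarith [mul_le_mul_of_nonneg_left h5 hf.c_pos.le]

/-- Both equations are tested with the same truncation of `u - v` and subtracted, so `g` cancels.
Monotonicity of `A` and the one-sided bound on `f` give an estimate independent of `m`. -/
theorem inner_sub_le_of_testedEquation (hσ : DiffusionCondition n p σ) (hβ : DampingCondition n β)
    (hf : SourceCondition f c) {g u u' v v' : L2 n} {U V : W n p σ β}
    (hU : W.Represents U u) (hV : W.Represents V v)
    (hu : ∫⁻ x, ENNReal.ofReal (f (u x) * u x) < ⊤)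
    (hv : ∫⁻ x, ENNReal.ofReal (f (v x) * v x) < ⊤)
    (hequ : ∀ K : ℕ, ∀ q ∈ boundedPairs p σ β K, TestedEquation f g u u' U q)
    (heqv : ∀ K : ℕ, ∀ q ∈ boundedPairs p σ β K, TestedEquation f g v v' V q) :
    inner ℝ (u' - v') (u - v) ≤ c * ‖u - v‖ ^ 2 := by
  obtain ⟨h, hsm, h0, hd0, hd1, hK, hlim⟩ := exists_smooth_truncation
  have habs : ∀ m s, |h m s| ≤ |s| := fun m s => by
    have := Convex.norm_image_sub_le_of_norm_deriv_le (f := h m) (C := 1) (s := univ)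
      (fun x _ => (hsm m).differentiable (by simp) x)
      (fun x _ => by rw [Real.norm_of_nonneg (hd0 m x)]; exact hd1 m x) convex_univ
      (mem_univ 0) (mem_univ s)
    simpa [h0] using this
  have hsign : ∀ m s, 0 ≤ s * h m s := fun m s => by
    have hm := monotone_of_deriv_nonneg ((hsm m).differentiable (by simp)) (hd0 m)
    rcases le_total 0 s with hs | hs
    · exact mul_nonneg hs (by simpa [h0] using hm hs)
    · exact mul_nonneg_of_nonpos_of_nonpos hs (by simpa [h0] using hm hs)
  have hW := hU.sub hV
  have hwm : StronglyMeasurable (u - v : L2 n) := Lp.stronglyMeasurable _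
  have key : ∀ m, ∫ x, (u' - v' : L2 n) x * h m ((u - v : L2 n) x) ≤ c * ‖u - v‖ ^ 2 := by
    intro m
    obtain ⟨z, b, hzb, hb, hz1, hz2⟩ := hW.exists_comp (hsm m) (h0 m)
      (fun s => abs_le.2 ⟨by linarith [hd0 m s], hd1 m s⟩)
    obtain ⟨K, hK⟩ := hK m
    have hbK : ∀ᵐ x, |b x| ≤ K := by
      filter_upwards [hb] with x hx
      rw [hx]
      exact hK _
    have e1 : TestedEquation f g u u' U (z, b) := hequ K (z, b) ⟨hzb, hbK⟩
    have e2 : TestedEquation f g v v' V (z, b) := heqv K (z, b) ⟨hzb, hbK⟩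
    simp only [TestedEquation, ← inner_eq_integral_mul] at e1 e2
    have hmon : 0 ≤ pairA U z - pairA V z := by
      refine pairA_sub_nonneg hσ.aemeasurable hσ.nonneg hβ.aemeasurable hβ.nonneg
        (fun x => hd0 m ((u - v : L2 n) x)) hz1 ?_
      filter_upwards [hz2, hW.snd_ae_eq] with x hx1 hx2
      rw [hx1, hx2]
      exact hsign m _
    have i1 := integrable_source_mul_of_bounded hf.contDiff hf.sign hu hbK
    have i2 := integrable_source_mul_of_bounded hf.contDiff hf.sign hv hbK
    have hsrc : -(c * ‖u - v‖ ^ 2) ≤ (∫ x, f (u x) * b x) - ∫ x, f (v x) * b x := by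
      rw [← integral_sub i1 i2, ← real_inner_self_eq_norm_sq, inner_eq_integral_mul,
        ← integral_const_mul, ← integral_neg]
      refine integral_mono_ae ((integrable_mul_of_Lp _ _).const_mul c).neg (i1.sub i2) ?_
      filter_upwards [hb, Lp.coeFn_sub u v] with x hx1 hx2
      rw [Pi.sub_apply] at hx2
      rw [hx1, hx2, ← sq, ← sub_mul]
      exact hf.sub_mul_ge (hsign m _) (habs m _)
    have hfin : inner ℝ (u' - v') b ≤ c * ‖u - v‖ ^ 2 := by
      rw [inner_sub_left]
      linarith
    rw [inner_eq_integral_mul] at hfin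
    refine le_of_eq_of_le (integral_congr_ae ?_) hfin
    filter_upwards [hb] with x hx
    rw [hx]
  -- The truncation is removed only here, where both factors are in `L²` and `|h_m(s)| ≤ |s|`
  -- provides the majorant.
  have hconv : Tendsto (fun m => ∫ x, (u' - v' : L2 n) x * h m ((u - v : L2 n) x)) atTop
      (𝓝 (∫ x, (u' - v' : L2 n) x * (u - v : L2 n) x)) := by
    refine tendsto_integral_of_dominated_convergence
      (fun x => ‖(u' - v' : L2 n) x * (u - v : L2 n) x‖) (fun m => ?_)
      (integrable_mul_of_Lp _ _).norm (fun m => .of_forall fun x => ?_) (.of_forall fun x => ?_)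
    · exact (Lp.aestronglyMeasurable _).mul
        ((hsm m).continuous.comp_stronglyMeasurable hwm).aestronglyMeasurable
    · rw [norm_mul, norm_mul]
      exact mul_le_mul_of_nonneg_left (habs m _) (norm_nonneg _)
    · exact (hlim _).const_mul _
  rw [inner_eq_integral_mul]
  exact le_of_tendsto' hconv key

theorem IsWeakSolution.norm_sub_le (hσ : DiffusionCondition n p σ) (hβ : DampingCondition n β)
    (hf : SourceCondition f c) {g : L2 n} {T : ℝ} {u₀ v₀ : L2 n} {u v : ℝ → L2 n}
    (hu : IsWeakSolution p σ β f g T u₀ u) (hv : IsWeakSolution p σ β f g T v₀ v) :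
    ∀ t ∈ Icc 0 T, ‖u t - v t‖ ≤ Real.exp (c * t) * ‖u₀ - v₀‖ := by
  obtain ⟨huc, rfl, huf, U, -, hU, u', hu', hequ⟩ := hu
  obtain ⟨hvc, rfl, hvf, V, -, hV, v', hv', heqv⟩ := hv
  have huf' := ae_lintegral_source_lt_top hf.contDiff.continuous huc huf
  have hvf' := ae_lintegral_source_lt_top hf.contDiff.continuous hvc hvf
  refine hu'.norm_sub_le huc hvc hv' ?_
  filter_upwards [hU, hV, huf', hvf', ae_forall_testedEquation hσ hβ hf huf' hequ,
    ae_forall_testedEquation hσ hβ hf hvf' heqv] with t a1 a2 a3 a4 a5 a6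
  exact inner_sub_le_of_testedEquation hσ hβ hf a1 a2 a3 a4 a5 a6

end

end WeightedPLaplace

theorem theorem3p2 (n : ℕ) (hn : 2 ≤ n) (p : ℝ) [Fact (2 ≤ p)]
    (σ β : WeightedPLaplace.Space n → ℝ) (f : ℝ → ℝ) (c : ℝ) (g : WeightedPLaplace.L2 n)
    (hσ : WeightedPLaplace.DiffusionCondition n p σ)
    (hβ : WeightedPLaplace.DampingCondition n β)
    (hf : WeightedPLaplace.SourceCondition f c)
    (T : ℝ) (hT : 0 ≤ T) (u₀ v₀ : WeightedPLaplace.L2 n) (u v : ℝ → WeightedPLaplace.L2 n)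
    (hu : WeightedPLaplace.IsWeakSolution p σ β f g T u₀ u)
    (hv : WeightedPLaplace.IsWeakSolution p σ β f g T v₀ v) :
    (∀ t ∈ Set.Icc (0 : ℝ) T, ‖u t - v t‖ ≤ Real.exp (c * t) * ‖u₀ - v₀‖) ∧
      (u₀ = v₀ → ∀ t ∈ Set.Icc (0 : ℝ) T, u t = v t) := by
  have h := hu.norm_sub_le hσ hβ hf hv
  refine ⟨h, fun h0 t ht => ?_⟩
  have := h t ht
  rw [h0, sub_self, norm_zero, mul_zero] at this
  exact sub_eq_zero.1 (norm_le_zero_iff.1 this)
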